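/- Let $k$ be a field of characteristic $0$ and let $$P=k((x_1))\cdots((x_n))((\partial_1^{-1}))\cdots((\partial_n^{-1}))$$ be the ring of formal pseudo-differential operators in $n$ variables, with product given by the Leibniz rule $$\Big(\sum_\alpha a_\alpha\partial^\alpha\Big)\Big(\sum_\beta b_\beta\partial^\beta\Big)=\sum_{\alpha,\beta;\,\gamma\ge 0}\binom{\alpha}{\gamma}a_\alpha\, d^\gamma(b_\beta)\,\partial^{\alpha+\beta-\gamma},\qquad d_i=\partial/\partial x_i .$$ For $L=\sum a_{i;j}x^i\partial^j\in P$ ($i,j\in\mathbb Z^n$) put $\operatorname{res}_P(L)=a_{-1,\dots,-1;-1,\dots,-1}$. On $P^n$ put $\langle L,M\rangle=\sum_{i=1}^n\operatorname{res}_P(L_iM_i)$ and let $[X,Y]$ be the componentwise commutator. Let $\mathcal F(P^n)$ be the space of functionals on $P^n$ that are polynomials of bounded degree in any (finite or infinite) number of coefficients of $L_1,\dots,L_n$, where at every point of $P^n$ all but finitely many monomials vanish. The gradient $\nabla_F(L)\in P^n$ is defined by $\langle M,\nabla_F(L)\rangle=\frac{d}{d\varepsilon}F(L+\varepsilon M)|_{\varepsilon=0}$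 for all $M\in P^n$. Let $P=P_+\oplus P_-$, where $P_+$ (resp. $P_-$) consists of the operators that contain only powers $\ge 0$ (resp. $<0$) of $\partial_n$, let $RX=X_+-X_-$ (componentwise on $P^n$), and let $[X,Y]_R=\frac12[RX,Y]+\frac12[X,RY]$. Put $$\{F,G\}(L)=\langle L,[\nabla_F(L),\nabla_G(L)]\rangle,\qquad \{F,G\}_R(L)=\langle L,[\nabla_F(L),\nabla_G(L)]_R\rangle .$$ For a multi-index $m=(m_1,\dots,m_n)$ with $m_i\ge 0$ put $H_m(L)=\operatorname{res}_P(L_1^{m_1}\cdots L_n^{m_n})$. Then every $H_m$ belongs to $\mathcal F(P^n)$, and every $F\in\mathcal F(P^n)$ has a unique gradient at every point of $P^n$, so that the brackets make sense. If $L\in P'$, that is, $L\in P^n$ and $[L_i,L_j]=0$ for all $i,j$, then for all multi-indices $m,l$ and all $F\in\mathcal F(P^n)$ $$\text{i)}\ \{H_m,F\}(L)=0,\qquad \text{ii)}\ \{H_m,H_l\}_R(L)=0 .$$ -/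

import Mathlib

/-! ### Iterated Laurent series -/

/-- Exponents `α ∈ ℤⁿ`, ordered lexicographically with the last coordinate most significant. -/
abbrev Expo (n : ℕ) : Type := Colex (Fin n → ℤ)

instance Expo.isOrderedCancelAddMonoid (n : ℕ) : IsOrderedCancelAddMonoid (Expo n) where
  add_le_add_left a b hab c := by
    rcases hab.lt_or_eq with h | h
    · obtain ⟨i, hi, hlt⟩ := h
      exact le_of_lt ⟨i, fun j hj => congrArg (· + c j) (hi j hj), add_lt_add_left hlt (c i)⟩
    · rw [h]
  le_of_add_le_add_left a b c hbc := by
    rcases hbc.lt_or_eq with h | h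
    · obtain ⟨i, hi, hlt⟩ := h
      exact le_of_lt ⟨i, fun j hj => add_left_cancel (hi j hj), lt_of_add_lt_add_left hlt⟩
    · exact (add_left_cancel h).le

/-- The iterated Laurent series `R((t₁))⋯((tₙ))`. A set of exponents is the support of an
iterated Laurent series (the exponents of `tₙ` are bounded below; for each exponent of `tₙ`
those of `tₙ₋₁` are bounded below, and so on) if and only if it is well-ordered for the
lexicographic order in which `tₙ` is most significant, so these are the Hahn series over
`Expo n`. -/
abbrev IterLaurent (n : ℕ) (R : Type*) [Zero R] : Type _ := HahnSeries (Expo n) R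

/-- The derivation `∂/∂xᵢ` of `k((x₁))⋯((xₙ))`. -/
noncomputable def partialDeriv {n : ℕ} {k : Type*} [Field k] (i : Fin n) :
    Module.End k (IterLaurent n k) where
  toFun f :=
    { coeff := fun s => ((s i + 1 : ℤ) : k) * f.coeff (s + toColex (Pi.single i 1))
      isPWO_support' := by
        have hm : Monotone fun s : Expo n => s - toColex (Pi.single i 1) := fun a b h => by
          simpa [sub_eq_add_neg] using add_le_add_left h (-toColex (Pi.single i 1))
        refine (f.isPWO_support.image_of_monotone hm).mono fun s hs => ?_
        exact ⟨s + toColex (Pi.single i 1), right_ne_zero_of_mul hs, by simp⟩ }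
  map_add' f g := by ext s; simp [mul_add]
  map_smul' c f := by ext s; simp [mul_left_comm]

/-- `d^γ = d₁^{γ₁} ⋯ dₙ^{γₙ}`, where `dᵢ = ∂/∂xᵢ`. -/
noncomputable def iterDeriv {n : ℕ} {k : Type*} [Field k] (γ : Fin n → ℕ) :
    Module.End k (IterLaurent n k) :=
  (List.ofFn fun i => partialDeriv i ^ γ i).prod

/-! ### Formal pseudo-differential operators -/

/-- The space `P = k((x₁))⋯((xₙ))((∂₁⁻¹))⋯((∂ₙ⁻¹))` of formal pseudo-differential operators
`∑ a_α ∂^α`, as iterated Laurent series in `∂₁⁻¹, …, ∂ₙ⁻¹` with coefficients in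
`k((x₁))⋯((xₙ))` written on the left. The product is not that of (commutative)
Laurent series; it is defined below. -/
def PsiDO (n : ℕ) (k : Type*) [Field k] : Type _ := IterLaurent n (IterLaurent n k)

namespace PsiDO

noncomputable instance (n : ℕ) (k : Type*) [Field k] : AddCommGroup (PsiDO n k) :=
  inferInstanceAs (AddCommGroup (IterLaurent n (IterLaurent n k)))

noncomputable instance (n : ℕ) (k : Type*) [Field k] : Module k (PsiDO n k) :=
  inferInstanceAs (Module k (IterLaurent n (IterLaurent n k)))

/-- The operator `1 = ∂⁰`. -/
noncomputable instance (n : ℕ) (k : Type*) [Field k] : One (PsiDO n k) :=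
  inferInstanceAs (One (IterLaurent n (IterLaurent n k)))

/-- The coefficient `a_α ∈ k((x₁))⋯((xₙ))` of `∂^α = ∂₁^{α₁} ⋯ ∂ₙ^{αₙ}`. -/
def coeff {n : ℕ} {k : Type*} [Field k] (L : PsiDO n k) (α : Fin n → ℤ) : IterLaurent n k :=
  HahnSeries.coeff L (toColex (-α))

/-- The term `binom(α, γ) a_α d^γ(b_β)` of the Leibniz rule for the product of `∑ a_α ∂^α` and
`∑ b_β ∂^β` that contributes to `∂^δ`, that is, with `α + β - γ = δ`; here `q = (α, γ)`. -/
noncomputable def mulTerm {n : ℕ} {k : Type*} [Field k] (L M : PsiDO n k) (δ : Fin n → ℤ)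
    (q : (Fin n → ℤ) × (Fin n → ℕ)) : IterLaurent n k :=
  (∏ i, Ring.choose (q.1 i) (q.2 i)) •
    (L.coeff q.1 * iterDeriv q.2 (M.coeff fun i => δ i - q.1 i + q.2 i))

/-- The set of the exponents `γ ≥ 0`. -/
def cone (n : ℕ) : Set (Expo n) := Set.range fun γ : Fin n → ℕ => toColex fun i => (γ i : ℤ)

theorem isPWO_cone (n : ℕ) : (cone n).IsPWO := by
  rw [cone, ← Set.image_univ]
  refine Set.IsPWO.image_of_monotone (Set.isPWO_of_wellQuasiOrderedLE _) ?_
  intro γ γ' h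
  exact Pi.toColex_monotone fun i => Int.ofNat_le.mpr (h i)

theorem mulTerm_support {n : ℕ} {k : Type*} [Field k] {L M : PsiDO n k} {δ : Fin n → ℤ}
    {q : (Fin n → ℤ) × (Fin n → ℕ)} (h : mulTerm L M δ q ≠ 0) :
    toColex (-q.1) ∈ HahnSeries.support L ∧
      toColex (-fun i => δ i - q.1 i + q.2 i) ∈ HahnSeries.support M := by
  refine ⟨fun h0 => h ?_, fun h0 => h ?_⟩
  · have : L.coeff q.1 = 0 := h0
    simp [mulTerm, this]
  · have : (M.coeff fun i => δ i - q.1 i + q.2 i) = 0 := h0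
    simp [mulTerm, this]

theorem expo_add_eq {n : ℕ} (δ : Fin n → ℤ) (q : (Fin n → ℤ) × (Fin n → ℕ)) :
    (toColex (-q.1) + (toColex (-fun i => δ i - q.1 i + q.2 i) +
      toColex fun i => (q.2 i : ℤ)) : Expo n) = toColex (-δ) := by
  apply ofColex.injective
  funext i
  change -q.1 i + (-(δ i - q.1 i + q.2 i) + (q.2 i : ℤ)) = -δ i
  ring

open Pointwise in
/-- Only finitely many terms contribute to each coefficient of the product. -/
theorem finite_mulTerm {n : ℕ} {k : Type*} [Field k] (L M : PsiDO n k) (δ : Fin n → ℤ) :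
    (Function.support (mulTerm L M δ)).Finite := by
  have hM : (HahnSeries.support M + cone n).IsPWO :=
    (HahnSeries.isPWO_support M).add (isPWO_cone n)
  have h1 : (Set.antidiagonal (HahnSeries.support L) (HahnSeries.support M + cone n)
      (toColex (-δ))).Finite :=
    Set.AddAntidiagonal.finite_of_isPWO (HahnSeries.isPWO_support L) hM _
  have h2 := h1.biUnion (t := fun p =>
      (fun r : Expo n × Expo n => (p.1, r)) ''
        Set.antidiagonal (HahnSeries.support M) (cone n) p.2)
    fun p _ => (Set.AddAntidiagonal.finite_of_isPWO (HahnSeries.isPWO_support M)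
      (isPWO_cone n) p.2).image _
  let φ : (Fin n → ℤ) × (Fin n → ℕ) → Expo n × Expo n × Expo n := fun q =>
    (toColex (-q.1), toColex (-fun i => δ i - q.1 i + q.2 i), toColex fun i => (q.2 i : ℤ))
  have hφ : Function.Injective φ := by
    rintro ⟨a, c⟩ ⟨a', c'⟩ h
    have ha : a = a' := neg_injective (toColex.injective (congrArg Prod.fst h))
    have hc : (fun i => (c i : ℤ)) = fun i => (c' i : ℤ) :=
      toColex.injective (congrArg (fun z => z.2.2) h)
    rw [ha, show c = c' from funext fun i => Int.ofNat_injective (congrFun hc i)]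
  refine Set.Finite.of_finite_image (h2.subset ?_) hφ.injOn
  rintro _ ⟨q, hq, rfl⟩
  obtain ⟨hL, hM'⟩ := mulTerm_support hq
  refine Set.mem_biUnion (x := (toColex (-q.1), toColex (-fun i => δ i - q.1 i + q.2 i) +
    toColex fun i => (q.2 i : ℤ))) ?_ ?_
  · exact ⟨hL, Set.add_mem_add hM' ⟨q.2, rfl⟩, expo_add_eq δ q⟩
  · exact ⟨_, ⟨hM', ⟨q.2, rfl⟩, rfl⟩, rfl⟩

open Pointwise in
/-- The product of pseudo-differential operators, given by the Leibniz rule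
`(∑ a_α ∂^α)(∑ b_β ∂^β) = ∑_{α, β, γ ≥ 0} binom(α, γ) a_α d^γ(b_β) ∂^{α + β - γ}`. -/
noncomputable instance (n : ℕ) (k : Type*) [Field k] : Mul (PsiDO n k) where
  mul L M := show HahnSeries (Expo n) (IterLaurent n k) from
    { coeff := fun s => ∑ᶠ q, mulTerm L M (-ofColex s) q
      isPWO_support' := by
        refine ((HahnSeries.isPWO_support L).add
          ((HahnSeries.isPWO_support M).add (isPWO_cone n))).mono fun s hs => ?_
        obtain ⟨q, hq⟩ : ∃ q, mulTerm L M (-ofColex s) q ≠ 0 := by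
          by_contra h
          exact hs (finsum_eq_zero_of_forall_eq_zero fun q => not_not.mp (not_exists.mp h q))
        obtain ⟨hL, hM⟩ := mulTerm_support hq
        have h := expo_add_eq (-ofColex s) q
        rw [neg_neg] at h
        exact ⟨_, hL, _, ⟨_, hM, _, ⟨q.2, rfl⟩, rfl⟩, h⟩ }

/-- The commutator `[L, M] = L M - M L`. -/
noncomputable instance (n : ℕ) (k : Type*) [Field k] : Bracket (PsiDO n k) (PsiDO n k) where
  bracket L M := L * M - M * L

/-- The residue `res_P(∑ a_{i; j} x^i ∂^j) = a_{-1, …, -1; -1, …, -1}`. -/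
def residue {n : ℕ} {k : Type*} [Field k] (L : PsiDO n k) : k :=
  (L.coeff fun _ => -1).coeff (toColex fun _ => -1)

/-- The terms `a_α ∂^α` of an operator with `α` in a given set. -/
noncomputable def restrict {n : ℕ} {k : Type*} [Field k] (A : Set (Fin n → ℤ)) (L : PsiDO n k) :
    PsiDO n k :=
  show HahnSeries (Expo n) (IterLaurent n k) from
    { coeff := ({s | -ofColex s ∈ A} : Set (Expo n)).indicator (HahnSeries.coeff L)
      isPWO_support' := (HahnSeries.isPWO_support L).mono fun s hs => by
        classical
        intro h0
        apply hs
        rw [Set.indicator_apply]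
        split_ifs
        · exact h0
        · rfl }

/-- The exponents whose last coordinate, the exponent of `∂ₙ`, is nonnegative. -/
def lastNonneg (n : ℕ) : Set (Fin n → ℤ) := {α | ∀ i : Fin n, (i : ℕ) + 1 = n → 0 ≤ α i}

/-- The component `L₊` of `L` in `P = P₊ + P₋`: the powers `≥ 0` of `∂ₙ`. -/
noncomputable def plusPart {n : ℕ} {k : Type*} [Field k] (L : PsiDO n k) : PsiDO n k :=
  restrict (lastNonneg n) L

/-- The component `L₋` of `L` in `P = P₊ + P₋`: the powers `< 0` of `∂ₙ`. -/
noncomputable def minusPart {n : ℕ} {k : Type*} [Field k] (L : PsiDO n k) : PsiDO n k :=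
  restrict (lastNonneg n)ᶜ L

/-! ### The space `Pⁿ` -/

/-- The variety `P'` of the `n`-tuples of operators that commute with each other. -/
def commutingVariety (n : ℕ) (k : Type*) [Field k] : Set (Fin n → PsiDO n k) :=
  {L | ∀ i j, ⁅L i, L j⁆ = 0}

/-- The monomial `L^m = L₁^{m₁} ⋯ Lₙ^{mₙ}`. -/
noncomputable def multiPow {n : ℕ} {k : Type*} [Field k] (L : Fin n → PsiDO n k)
    (m : Fin n → ℕ) : PsiDO n k :=
  (List.ofFn fun i => npowRec (m i) (L i)).prod

/-- The function `H_m(L) = res_P(L^m)` on `Pⁿ`. -/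
noncomputable def hamiltonian {n : ℕ} {k : Type*} [Field k] (m : Fin n → ℕ)
    (L : Fin n → PsiDO n k) : k :=
  residue (multiPow L m)

/-- The pairing `⟨L, M⟩ = ∑ res_P(Lᵢ Mᵢ)` on `Pⁿ`. -/
noncomputable def pairing {n : ℕ} {k : Type*} [Field k] (L M : Fin n → PsiDO n k) : k :=
  ∑ i, residue (L i * M i)

/-- The Lie bracket of `Pⁿ`, taken componentwise. -/
noncomputable def lie {n : ℕ} {k : Type*} [Field k] (X Y : Fin n → PsiDO n k) :
    Fin n → PsiDO n k :=
  fun i => ⁅X i, Y i⁆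

/-- The `R`-matrix `R X = X₊ - X₋`, the difference of the projectors. -/
noncomputable def rMatrix {n : ℕ} {k : Type*} [Field k] (X : Fin n → PsiDO n k) :
    Fin n → PsiDO n k :=
  fun i => plusPart (X i) - minusPart (X i)

/-- The Lie bracket `[X, Y]_R = ½ [R X, Y] + ½ [X, R Y]` of `Pⁿ`. -/
noncomputable def lieR {n : ℕ} {k : Type*} [Field k] (X Y : Fin n → PsiDO n k) :
    Fin n → PsiDO n k :=
  (2⁻¹ : k) • lie (rMatrix X) Y + (2⁻¹ : k) • lie X (rMatrix Y)

/-! ### Functionals, gradients and Poisson brackets -/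

/-- The coordinate functions on `Pⁿ`: `(i, α, β)` stands for the coefficient of `x^α ∂^β`
in `Lᵢ`. -/
abbrev CoordIndex (n : ℕ) : Type := Fin n × (Fin n → ℤ) × (Fin n → ℤ)

/-- The value of a coordinate function. -/
def coord {n : ℕ} {k : Type*} [Field k] (L : Fin n → PsiDO n k) (v : CoordIndex n) : k :=
  ((L v.1).coeff v.2.2).coeff (toColex v.2.1)

/-- The value at `L` of the monomial `c m · ∏ v^{m v}` in the coordinates `v`. -/
noncomputable def monomialValue {n : ℕ} {k : Type*} [Field k] (c : (CoordIndex n →₀ ℕ) → k)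
    (L : Fin n → PsiDO n k) (m : CoordIndex n →₀ ℕ) : k :=
  c m * m.prod fun v e => coord L v ^ e

/-- The space `ℱ(Pⁿ)` of functionals: polynomials (of bounded degree) in any number, finite or
infinite, of coordinates; at each point of `Pⁿ` all but finitely many of their monomials
vanish. -/
def functionals (n : ℕ) (k : Type*) [Field k] : Set ((Fin n → PsiDO n k) → k) :=
  {F | ∃ c : (CoordIndex n →₀ ℕ) → k,
    (∃ N : ℕ, ∀ m, c m ≠ 0 → m.degree ≤ N) ∧
    ∀ L, (Function.support (monomialValue c L)).Finite ∧ F L = ∑ᶠ m, monomialValue c L m}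

/-- `c` is the derivative `d/dε F(L + ε M)` at `ε = 0`: along the line, `F` is given by a
polynomial in `ε` whose derivative at `0` is `c`. -/
def HasDerivAlong {n : ℕ} {k : Type*} [Field k] (F : (Fin n → PsiDO n k) → k)
    (L M : Fin n → PsiDO n k) (c : k) : Prop :=
  ∃ p : Polynomial k, (∀ ε : k, F (L + ε • M) = p.eval ε) ∧ p.derivative.eval 0 = c

/-- `U` is the gradient of `F` at `L`: `⟨M, U⟩ = d/dε F(L + ε M)` at `ε = 0`, for all `M`. -/
def IsGradient {n : ℕ} {k : Type*} [Field k] (F : (Fin n → PsiDO n k) → k)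
    (L U : Fin n → PsiDO n k) : Prop :=
  ∀ M, HasDerivAlong F L M (pairing M U)

open Classical in
/-- The gradient `∇_F(L)` (and `0` if there is none). -/
noncomputable def gradient {n : ℕ} {k : Type*} [Field k] (F : (Fin n → PsiDO n k) → k)
    (L : Fin n → PsiDO n k) : Fin n → PsiDO n k :=
  if h : ∃ U, IsGradient F L U then h.choose else 0

/-- The Poisson bracket `{F, G}(L) = ⟨L, [∇_F(L), ∇_G(L)]⟩`. -/
noncomputable def poisson {n : ℕ} {k : Type*} [Field k] (F G : (Fin n → PsiDO n k) → k)
    (L : Fin n → PsiDO n k) : k :=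
  pairing L (lie (gradient F L) (gradient G L))

/-- The Poisson bracket `{F, G}_R(L) = ⟨L, [∇_F(L), ∇_G(L)]_R⟩`. -/
noncomputable def poissonR {n : ℕ} {k : Type*} [Field k] (F G : (Fin n → PsiDO n k) → k)
    (L : Fin n → PsiDO n k) : k :=
  pairing L (lieR (gradient F L) (gradient G L))

end PsiDO

/-!
An operator is a strongly convergent sum of its monomials `x^a ∂^α`, and the coefficient of `LM` at
a given exponent is a finite sum, weighted by a product of one-variable integers. An identity
between these integers thus becomes one on `P`: this gives associativity and
`res (LM) = res (ML)`. The gradient of a functional is the sum of the duals of the monomials,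
weighted by its partial derivatives.

The gradient of `L ↦ res (L_{i₁} ⋯ L_{iᵣ})` is the cyclic derivative of the word, so on the
commuting variety its components commute with every `Lᵢ`. If `Xᵢ` commutes with `Lᵢ`, the trace
property gives `res (Lᵢ [Xᵢ, Yᵢ]) = res ([Lᵢ, Xᵢ] Yᵢ) = 0` for arbitrary `Y`, hence the vanishing of
both brackets.
-/

namespace PsiDO

section LeibnizWeight

open Finset

/-- The weight `binom(α, g) b(b - 1)⋯(b - g + 1)` with which `x^(b - g) ∂^(α - g)` occurs in
`∂^α x^b`, in one variable. -/
noncomputable def leibnizWeight (α b : ℤ) (g : ℕ) : ℤ :=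
  Ring.choose α g * (descPochhammer ℤ g).eval b

theorem leibnizWeight_zero (α b : ℤ) : leibnizWeight α b 0 = 1 := by
  simp [leibnizWeight]

theorem leibnizWeight_zero_left (b : ℤ) {g : ℕ} (hg : g ≠ 0) : leibnizWeight 0 b g = 0 := by
  rw [leibnizWeight, Ring.choose_zero_pos ℤ (Nat.pos_of_ne_zero hg), zero_mul]

theorem eval_descPochhammer_eq (b : ℤ) (g : ℕ) :
    (descPochhammer ℤ g).eval b = g.factorial * Ring.choose b g := by
  rw [Polynomial.eval_eq_smeval, Ring.descPochhammer_eq_factorial_smul_choose, nsmul_eq_mul]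

theorem leibnizWeight_comm (α b : ℤ) (g : ℕ) : leibnizWeight α b g = leibnizWeight b α g := by
  simp only [leibnizWeight, eval_descPochhammer_eq]
  ring

theorem eval_descPochhammer_add (c : ℤ) (g j : ℕ) :
    (descPochhammer ℤ (g + j)).eval c =
      (descPochhammer ℤ g).eval c * (descPochhammer ℤ j).eval (c - g) := by
  rw [← descPochhammer_mul]
  simp

theorem leibnizWeight_add_left (α β c : ℤ) (m : ℕ) :
    leibnizWeight (α + β) c m =
      ∑ x ∈ antidiagonal m, leibnizWeight α c x.1 * leibnizWeight β (c - x.1) x.2 := by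
  rw [leibnizWeight, Ring.add_choose_eq m (Commute.all α β), sum_mul]
  refine sum_congr rfl fun x hx => ?_
  rw [← HasAntidiagonal.mem_antidiagonal.mp hx, eval_descPochhammer_add, leibnizWeight,
    leibnizWeight]
  ring

theorem leibnizWeight_add_right (α b c : ℤ) (m : ℕ) :
    leibnizWeight α (b + c) m =
      ∑ x ∈ antidiagonal m, leibnizWeight α b x.1 * leibnizWeight (α - x.1) c x.2 := by
  simp only [leibnizWeight_comm α, leibnizWeight_add_left, leibnizWeight_comm c]

theorem sum_antidiagonal_left_comm {A : Type*} [AddCommMonoid A] (F : ℕ → ℕ → ℕ → A) (m : ℕ) :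
    ∑ x ∈ antidiagonal m, ∑ y ∈ antidiagonal x.2, F x.1 y.1 y.2 =
      ∑ x ∈ antidiagonal m, ∑ y ∈ antidiagonal x.2, F y.1 x.1 y.2 := by
  rw [sum_sigma', sum_sigma']
  refine sum_nbij' (fun z => ⟨(z.2.1, z.1.1 + z.2.2), (z.1.1, z.2.2)⟩)
    (fun z => ⟨(z.2.1, z.1.1 + z.2.2), (z.1.1, z.2.2)⟩) ?_ ?_ ?_ ?_ fun _ _ => rfl
  all_goals
    rintro ⟨⟨a, b⟩, ⟨c, d⟩⟩ h
    simp only [mem_sigma, HasAntidiagonal.mem_antidiagonal] at h ⊢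
  · exact ⟨by omega, trivial⟩
  · exact ⟨by omega, trivial⟩
  · rw [h.2]
  · rw [h.2]

-- In one variable, this is associativity on monomials.
theorem sum_leibnizWeight_mul_leibnizWeight (α b β c : ℤ) (m : ℕ) :
    ∑ x ∈ antidiagonal m, leibnizWeight α b x.1 * leibnizWeight (α + β - x.1) c x.2 =
      ∑ x ∈ antidiagonal m, leibnizWeight β c x.1 * leibnizWeight α (b + c - x.1) x.2 := by
  have left (x : ℕ × ℕ) : α + β - x.1 = β + (α - x.1) := by ring
  simp only [left, leibnizWeight_add_left, add_sub_assoc, leibnizWeight_add_right, mul_sum]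
  rw [sum_antidiagonal_left_comm (fun i g j =>
    leibnizWeight α b i * (leibnizWeight β c g * leibnizWeight (α - i) (c - g) j))]
  simp only [mul_left_comm]

theorem choose_sub_one_sub (a : ℤ) (g : ℕ) :
    Ring.choose ((g : ℤ) - 1 - a) g = (-1) ^ g * Ring.choose a g := by
  rw [show (g : ℤ) - 1 - a = -(a - g + 1) by ring, Ring.choose_neg,
    show a - g + 1 + (g : ℤ) - 1 = a by ring, Int.negOnePow_def]
  simp [Units.smul_def]

-- In one variable, this is `res (LM) = res (ML)` on monomials.
theorem leibnizWeight_reflect (α a : ℤ) (g : ℕ) :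
    leibnizWeight α (g - 1 - a) g = leibnizWeight (g - 1 - α) a g := by
  simp only [leibnizWeight, eval_descPochhammer_eq, choose_sub_one_sub]
  ring

end LeibnizWeight

variable {n : ℕ} {k : Type*} [Field k]

section Small

/-- The pairs `(a, α)` of exponents of the monomials `x^a ∂^α`. -/
abbrev Bideg (n : ℕ) : Type := (Fin n → ℤ) × (Fin n → ℤ)

/-- The bidegree of `x^γ ∂^γ`, by which the exponents drop in the term of the Leibniz rule with
index `γ`. -/
def diag : (Fin n → ℕ) →+ Bideg n where
  toFun γ := (fun i => (γ i : ℤ), fun i => (γ i : ℤ))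
  map_zero' := rfl
  map_add' γ γ' := by ext i <;> simp

theorem diag_injective : Function.Injective (diag : (Fin n → ℕ) → Bideg n) := fun _ _ h =>
  funext fun i => Int.ofNat_injective (congrFun (congrArg Prod.fst h) i)

/-- The exponent of `x^a ∂^α` in the Hahn series underlying the iterated Laurent series; the sign
of `α` is reversed because these are series in `∂⁻¹`. -/
def lexKey : Bideg n ≃+ Expo n ×ₗ Expo n where
  toFun p := toLex (toColex (-p.2), toColex p.1)
  invFun z := (ofColex (ofLex z).2, -ofColex (ofLex z).1)
  left_inv p := by simp
  right_inv z := by simp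
  map_add' p q := by rw [Prod.snd_add, Prod.fst_add, neg_add]; rfl

theorem lexKey_neg_diag_monotone : Monotone fun γ : Fin n → ℕ => lexKey (-diag γ) := by
  intro γ γ' h
  obtain rfl | hlt := h.eq_or_lt
  · exact le_rfl
  · refine Prod.Lex.left _ _ (Pi.toColex_strictMono (lt_of_le_of_ne (fun i => ?_) fun heq => ?_))
    · simpa [diag] using h i
    · exact hlt.ne (funext fun i => by simpa [diag] using congrFun heq i)

/-- The sets of bidegrees that occur as supports of operators. -/
def IsSmall (S : Set (Bideg n)) : Prop := (lexKey '' S).IsPWO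

theorem IsSmall.mono {S T : Set (Bideg n)} (hT : IsSmall T) (h : S ⊆ T) : IsSmall S :=
  Set.IsPWO.mono hT (Set.image_mono h)

open Pointwise in
theorem IsSmall.add {S T : Set (Bideg n)} (hS : IsSmall S) (hT : IsSmall T) :
    IsSmall (S + T) := by
  rw [IsSmall, Set.image_add]
  exact Set.IsPWO.add hS hT

theorem isSmall_range_neg_diag : IsSmall (Set.range fun γ : Fin n → ℕ => -diag γ) := by
  rw [IsSmall, ← Set.range_comp, ← Set.image_univ]
  exact (Set.isPWO_of_wellQuasiOrderedLE _).image_of_monotone lexKey_neg_diag_monotone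

theorem IsSmall.finite_inter_sub {S T : Set (Bideg n)} (hS : IsSmall S) (hT : IsSmall T)
    (s : Bideg n) : {p | p ∈ S ∧ s - p ∈ T}.Finite := by
  refine ((Set.AddAntidiagonal.finite_of_isPWO hS hT (lexKey s)).preimage
    (f := fun p => (lexKey p, lexKey (s - p))) ?_).subset ?_
  · exact fun p _ q _ h => lexKey.injective (congrArg Prod.fst h)
  · rintro p ⟨hp, hq⟩
    exact ⟨⟨p, hp, rfl⟩, ⟨s - p, hq, rfl⟩, by simp only [← map_add, add_sub_cancel]⟩

open Pointwise in
theorem IsSmall.finite_leibniz {S T : Set (Bideg n)} (hS : IsSmall S) (hT : IsSmall T)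
    (s : Bideg n) :
    {z : Bideg n × (Fin n → ℕ) | z.1 ∈ S ∧ s - z.1 + diag z.2 ∈ T}.Finite := by
  have finite_left := hS.finite_inter_sub (hT.add isSmall_range_neg_diag) s
  have finite_right (p : Bideg n) : {γ : Fin n → ℕ | s - p + diag γ ∈ T}.Finite := by
    refine ((isSmall_range_neg_diag.finite_inter_sub hT (s - p)).preimage
      (neg_injective.comp diag_injective).injOn).subset fun γ hγ => ⟨⟨γ, rfl⟩, ?_⟩
    simpa using hγ
  refine (finite_left.biUnion fun p _ => (Set.finite_singleton p).prod (finite_right p)).subset ?_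
  rintro ⟨p, γ⟩ ⟨hp, hq⟩
  exact Set.mem_biUnion ⟨hp, _, hq, _, ⟨γ, rfl⟩, by simp⟩ ⟨rfl, hq⟩

-- A descending sequence in `e - S` would give an ascending one in `S`, whose range is small.
theorem isSmall_of_finite_inter (S : Set (Bideg n)) (e : Bideg n)
    (h : ∀ T, IsSmall T → (S ∩ T).Finite) : IsSmall {p | e - p ∈ S} := by
  unfold IsSmall
  refine Set.IsWF.isPWO (Set.isWF_iff_no_descending_seq.mpr fun f hf hmem => ?_)
  choose p hp hpf using hmem
  have monotone_sub : Monotone fun m => lexKey (e - p m) := fun a b hab => by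
    simp only [map_sub, hpf]
    exact sub_le_sub_left (hf.antitone hab) _
  have injective_p : Function.Injective fun m => e - p m := fun a b hab =>
    hf.injective (by rw [← hpf, ← hpf, sub_right_injective hab])
  have small_range : IsSmall (Set.range fun m => e - p m) := by
    rw [IsSmall, ← Set.range_comp, ← Set.image_univ]
    exact (Set.isPWO_of_wellQuasiOrderedLE _).image_of_monotone monotone_sub
  refine Set.infinite_range_of_injective injective_p ((h _ small_range).subset ?_)
  rintro _ ⟨m, rfl⟩
  exact ⟨hp m, m, rfl⟩

end Small

section ScalarCoeff

/-- The coefficient of `x^a ∂^α` in an operator, where `p = (a, α)`. -/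
def scalarCoeff (L : PsiDO n k) (p : Bideg n) : k := (L.coeff p.2).coeff (toColex p.1)

theorem scalarCoeff_injective : Function.Injective (scalarCoeff : PsiDO n k → Bideg n → k) := by
  intro L M h
  apply (HahnSeries.iterateEquiv (Γ := Expo n) (Γ' := Expo n) (R := k)).injective
  ext z
  obtain ⟨p, rfl⟩ := lexKey.surjective z
  exact congrFun h p

theorem isSmall_support_scalarCoeff (L : PsiDO n k) :
    IsSmall (Function.support (scalarCoeff L)) := by
  refine Set.IsPWO.mono
    (HahnSeries.iterateEquiv (Γ := Expo n) (Γ' := Expo n) (R := k) L).isPWO_support ?_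
  rintro _ ⟨p, hp, rfl⟩
  exact hp

theorem exists_scalarCoeff_eq (f : Bideg n → k) (hf : IsSmall (Function.support f)) :
    ∃ L : PsiDO n k, scalarCoeff L = f := by
  let g : HahnSeries (Expo n ×ₗ Expo n) k :=
    { coeff := fun z => f (lexKey.symm z)
      isPWO_support' := Set.IsPWO.mono hf fun z hz => ⟨_, hz, lexKey.apply_symm_apply z⟩ }
  exact ⟨HahnSeries.iterateEquiv.symm g, funext fun p => congrArg f (lexKey.symm_apply_apply p)⟩

theorem scalarCoeff_add (L M : PsiDO n k) :
    scalarCoeff (L + M) = scalarCoeff L + scalarCoeff M := rfl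

theorem scalarCoeff_smul (c : k) (L : PsiDO n k) : scalarCoeff (c • L) = c • scalarCoeff L := rfl

/-- The operator `x^a ∂^α`, where `p = (a, α)`. -/
noncomputable def monomial (p : Bideg n) : PsiDO n k :=
  show HahnSeries (Expo n) (IterLaurent n k) from
    HahnSeries.single (toColex (-p.2)) (HahnSeries.single (toColex p.1) 1)

theorem one_eq_monomial : (1 : PsiDO n k) = monomial 0 :=
  congrArg (fun s => (HahnSeries.single s 1 : HahnSeries (Expo n) (IterLaurent n k)))
    (congrArg toColex neg_zero.symm)

theorem scalarCoeff_monomial [DecidableEq (Bideg n)] (p : Bideg n) :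
    scalarCoeff (monomial p : PsiDO n k) = Pi.single p 1 := by
  funext q
  change HahnSeries.coeff (HahnSeries.coeff (HahnSeries.single (toColex (-p.2))
    (HahnSeries.single (toColex p.1) (1 : k))) (toColex (-q.2))) (toColex q.1) = _
  by_cases hsnd : q.2 = p.2
  · rw [hsnd, HahnSeries.coeff_single_same]
    by_cases hfst : q.1 = p.1
    · rw [hfst, HahnSeries.coeff_single_same, Prod.ext hfst hsnd, Pi.single_eq_same]
    · have hne : toColex q.1 ≠ toColex p.1 := fun h => hfst (toColex.injective h)
      rw [HahnSeries.coeff_single_of_ne hne, Pi.single_eq_of_ne (mt (congrArg Prod.fst) hfst)]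
  · have hne : toColex (-q.2) ≠ toColex (-p.2) := fun h =>
      hsnd (neg_injective (toColex.injective h))
    rw [HahnSeries.coeff_single_of_ne hne, HahnSeries.coeff_zero,
      Pi.single_eq_of_ne (mt (congrArg Prod.snd) hsnd)]

theorem residue_eq_scalarCoeff (L : PsiDO n k) : residue L = scalarCoeff L (-1) := rfl

end ScalarCoeff

section MulFormula

theorem coeff_mul_eq_finsum {Γ R : Type*} [AddCommGroup Γ] [PartialOrder Γ]
    [IsOrderedCancelAddMonoid Γ] [NonUnitalNonAssocSemiring R] (f g : HahnSeries Γ R) (c : Γ) :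
    (f * g).coeff c = ∑ᶠ a, f.coeff a * g.coeff (c - a) := by
  classical
  rw [HahnSeries.coeff_mul, finsum_eq_sum_of_support_subset (s := (Finset.antidiagonal
    f.isPWO_support g.isPWO_support c).image Prod.fst), Finset.sum_image]
  · refine Finset.sum_congr rfl fun x hx => ?_
    rw [← (Finset.mem_antidiagonal.mp hx).2.2, add_sub_cancel_left]
  · rintro ⟨a, b⟩ hx ⟨_, b'⟩ hy (rfl : a = _)
    have hb := (Finset.mem_antidiagonal.mp hx).2.2.trans (Finset.mem_antidiagonal.mp hy).2.2.symm
    exact Prod.ext rfl (add_left_cancel hb)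
  · intro a ha
    exact Finset.mem_coe.mpr (Finset.mem_image.mpr ⟨(a, c - a), Finset.mem_antidiagonal.mpr
      ⟨left_ne_zero_of_mul ha, right_ne_zero_of_mul ha, add_sub_cancel a c⟩, rfl⟩)

theorem coeff_partialDeriv_pow (i : Fin n) (g : ℕ) (f : IterLaurent n k) (s : Expo n) :
    ((partialDeriv i ^ g) f).coeff s = (((descPochhammer ℤ g).eval (s i + g) : ℤ) : k) *
      f.coeff (s + toColex (Pi.single i (g : ℤ))) := by
  induction g generalizing s with
  | zero => simp
  | succ g ih =>
    have shift_apply : (s + toColex (Pi.single i 1) : Expo n) i = s i + 1 :=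
      congrArg (s i + ·) (Pi.single_eq_same i 1)
    have shift_shift : s + toColex (Pi.single i 1) + toColex (Pi.single i (g : ℤ)) =
        (s + toColex (Pi.single i ((g + 1 : ℕ) : ℤ)) : Expo n) := by
      rw [add_assoc, ← toColex_add, ← Pi.single_add, Nat.cast_succ, add_comm (1 : ℤ)]
    rw [pow_succ']
    change ((s i + 1 : ℤ) : k) * ((partialDeriv i ^ g) f).coeff (s + toColex (Pi.single i 1)) = _
    rw [ih, shift_apply, shift_shift, descPochhammer_succ_eval, ← mul_assoc, ← Int.cast_mul]
    congr 2
    push_cast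
    rw [mul_comm, show s i + 1 + (g : ℤ) = s i + (g + 1) by ring]
    ring

theorem coeff_prod_partialDeriv (γ : Fin n → ℕ) (l : List (Fin n)) (hl : l.Nodup)
    (f : IterLaurent n k) (s : Expo n) :
    ((l.map fun i => partialDeriv i ^ γ i).prod f).coeff s =
      (l.map fun i => (((descPochhammer ℤ (γ i)).eval (s i + γ i) : ℤ) : k)).prod *
        f.coeff (s + toColex (l.map fun i => (Pi.single i (γ i : ℤ) : Fin n → ℤ)).sum) := by
  induction l generalizing s with
  | nil => simp
  | cons i l ih =>
    obtain ⟨hi, hl⟩ := List.nodup_cons.mp hl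
    have shift_apply (j : Fin n) (hj : j ∈ l) :
        (s + toColex (Pi.single i (γ i : ℤ)) : Expo n) j = s j := by
      refine (congrArg (s j + ·) (Pi.single_eq_of_ne ?_ _)).trans (add_zero _)
      rintro rfl
      exact hi hj
    rw [List.map_cons, List.prod_cons, Module.End.mul_apply, coeff_partialDeriv_pow, ih hl,
      List.map_congr_left fun j hj => by rw [shift_apply j hj], List.map_cons, List.prod_cons,
      List.map_cons, List.sum_cons, toColex_add, add_assoc, mul_assoc]

theorem coeff_iterDeriv (γ : Fin n → ℕ) (f : IterLaurent n k) (b : Fin n → ℤ) :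
    (iterDeriv γ f).coeff (toColex b) =
      (∏ i, (((descPochhammer ℤ (γ i)).eval (b i + γ i) : ℤ) : k)) *
        f.coeff (toColex fun i => b i + γ i) := by
  rw [iterDeriv, List.ofFn_eq_map, coeff_prod_partialDeriv _ _ (List.nodup_finRange n),
    ← Fin.prod_univ_def, ← Fin.sum_univ_def, Finset.univ_sum_single]
  rfl

/-- The coefficient of `x^(a + b - γ) ∂^(α + β - γ)` in the product of `x^a ∂^α` and `x^b ∂^β`,
where `p = (a, α)` and `q = (b, β)`. -/
noncomputable def leibnizCoeff (p q : Bideg n) (γ : Fin n → ℕ) : ℤ :=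
  ∏ i, leibnizWeight (p.2 i) (q.1 i) (γ i)

theorem coeff_mulTerm (L M : PsiDO n k) (c δ α : Fin n → ℤ) (γ : Fin n → ℕ) :
    (mulTerm L M δ (α, γ)).coeff (toColex c) =
      ∑ᶠ a : Fin n → ℤ, (leibnizCoeff (a, α) ((c, δ) - (a, α) + diag γ) γ : k) *
        (scalarCoeff L (a, α) * scalarCoeff M ((c, δ) - (a, α) + diag γ)) := by
  rw [mulTerm, HahnSeries.coeff_smul, coeff_mul_eq_finsum, ← Int.cast_smul_eq_zsmul k,
    smul_eq_mul, mul_finsum, ← finsum_comp_equiv (toColex : (Fin n → ℤ) ≃ _)]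
  refine finsum_congr fun a => ?_
  have leibnizCoeff_eq : leibnizCoeff (a, α) ((c, δ) - (a, α) + diag γ) γ =
      (∏ i, Ring.choose (α i) (γ i)) *
        ∏ i, (descPochhammer ℤ (γ i)).eval (c i - a i + γ i) :=
    Finset.prod_mul_distrib
  rw [← toColex_sub, coeff_iterDeriv, leibnizCoeff_eq, Int.cast_mul, ← Int.cast_prod, mul_assoc]
  congr 1
  exact mul_left_comm _ _ _

theorem finite_support_mul (L M : PsiDO n k) (s : Bideg n) :
    (Function.support fun z : Bideg n × (Fin n → ℕ) =>
      (leibnizCoeff z.1 (s - z.1 + diag z.2) z.2 : k) *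
        (scalarCoeff L z.1 * scalarCoeff M (s - z.1 + diag z.2))).Finite :=
  ((isSmall_support_scalarCoeff L).finite_leibniz (isSmall_support_scalarCoeff M) s).subset
    fun _ hz => mul_ne_zero_iff.mp (right_ne_zero_of_mul hz)

theorem scalarCoeff_mul (L M : PsiDO n k) (s : Bideg n) :
    scalarCoeff (L * M) s = ∑ᶠ z : Bideg n × (Fin n → ℕ),
      (leibnizCoeff z.1 (s - z.1 + diag z.2) z.2 : k) *
        (scalarCoeff L z.1 * scalarCoeff M (s - z.1 + diag z.2)) := by
  obtain ⟨c, δ⟩ := s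
  let F : Bideg n × (Fin n → ℕ) → k := fun z =>
    (leibnizCoeff z.1 ((c, δ) - z.1 + diag z.2) z.2 : k) *
      (scalarCoeff L z.1 * scalarCoeff M ((c, δ) - z.1 + diag z.2))
  let e : ((Fin n → ℤ) × (Fin n → ℕ)) × (Fin n → ℤ) ≃ Bideg n × (Fin n → ℕ) :=
    { toFun := fun z => ((z.2, z.1.1), z.1.2)
      invFun := fun z => ((z.1.2, z.2), z.1.1)
      left_inv := fun _ => rfl
      right_inv := fun _ => rfl }
  calc scalarCoeff (L * M) (c, δ) = ∑ᶠ q, (mulTerm L M δ q).coeff (toColex c) := by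
        change HahnSeries.coeff (∑ᶠ q, mulTerm L M (-(-δ)) q) (toColex c) = _
        rw [neg_neg]
        exact (HahnSeries.coeff.addMonoidHom (toColex c)).map_finsum (finite_mulTerm L M δ)
    _ = ∑ᶠ q, ∑ᶠ a, F (e (q, a)) := finsum_congr fun q => coeff_mulTerm L M c δ q.1 q.2
    _ = ∑ᶠ y, F (e y) := (finsum_curry (fun y => F (e y))
        ((finite_support_mul L M (c, δ)).preimage e.injective.injOn)).symm
    _ = ∑ᶠ z, F z := finsum_comp_equiv e

theorem exists_of_scalarCoeff_mul_ne_zero {L M : PsiDO n k} {s : Bideg n}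
    (h : scalarCoeff (L * M) s ≠ 0) :
    ∃ p q γ, scalarCoeff L p ≠ 0 ∧ scalarCoeff M q ≠ 0 ∧ p + q - diag γ = s := by
  obtain ⟨⟨p, γ⟩, hz⟩ : ∃ z : Bideg n × (Fin n → ℕ),
      (leibnizCoeff z.1 (s - z.1 + diag z.2) z.2 : k) *
        (scalarCoeff L z.1 * scalarCoeff M (s - z.1 + diag z.2)) ≠ 0 := by
    by_contra! hall
    exact h ((scalarCoeff_mul L M s).trans (finsum_eq_zero_of_forall_eq_zero hall))
  obtain ⟨hp, hq⟩ := mul_ne_zero_iff.mp (right_ne_zero_of_mul hz)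
  exact ⟨p, s - p + diag γ, γ, hp, hq, by abel⟩

end MulFormula

section Bilinear

protected theorem add_mul (L M N : PsiDO n k) : (L + M) * N = L * N + M * N := by
  refine scalarCoeff_injective (funext fun s => ?_)
  rw [scalarCoeff_add, Pi.add_apply, scalarCoeff_mul, scalarCoeff_mul, scalarCoeff_mul,
    ← finsum_add_distrib (finite_support_mul L N s) (finite_support_mul M N s)]
  exact finsum_congr fun z => by rw [scalarCoeff_add, Pi.add_apply, add_mul, mul_add]

protected theorem mul_add (L M N : PsiDO n k) : L * (M + N) = L * M + L * N := by
  refine scalarCoeff_injective (funext fun s => ?_)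
  rw [scalarCoeff_add, Pi.add_apply, scalarCoeff_mul, scalarCoeff_mul, scalarCoeff_mul,
    ← finsum_add_distrib (finite_support_mul L M s) (finite_support_mul L N s)]
  exact finsum_congr fun z => by rw [scalarCoeff_add, Pi.add_apply, mul_add, mul_add]

protected theorem smul_mul_assoc (c : k) (L M : PsiDO n k) : (c • L) * M = c • (L * M) := by
  refine scalarCoeff_injective (funext fun s => ?_)
  rw [scalarCoeff_smul, Pi.smul_apply, scalarCoeff_mul, scalarCoeff_mul, smul_finsum]
  exact finsum_congr fun z => by
    rw [scalarCoeff_smul, Pi.smul_apply, smul_mul_assoc, mul_smul_comm]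

protected theorem mul_smul_comm (c : k) (L M : PsiDO n k) : L * (c • M) = c • (L * M) := by
  refine scalarCoeff_injective (funext fun s => ?_)
  rw [scalarCoeff_smul, Pi.smul_apply, scalarCoeff_mul, scalarCoeff_mul, smul_finsum]
  exact finsum_congr fun z => by
    rw [scalarCoeff_smul, Pi.smul_apply, mul_smul_comm, mul_smul_comm]

end Bilinear

section Finsum

theorem finsum_finsum_comm {A X Y : Type*} [AddCommMonoid A] (f : X × Y → A)
    (hf : (Function.support f).Finite) :
    ∑ᶠ x, ∑ᶠ y, f (x, y) = ∑ᶠ y, ∑ᶠ x, f (x, y) := by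
  rw [← finsum_curry f hf, ← finsum_comp_equiv (Equiv.prodComm Y X)]
  exact finsum_curry _ (hf.preimage (Equiv.prodComm Y X).injective.injOn)

theorem finsum_mul_finsum {R X Y : Type*} [NonUnitalNonAssocSemiring R] (f : X → R) (g : Y → R)
    (hf : (Function.support f).Finite) (hg : (Function.support g).Finite) :
    (∑ᶠ x, f x) * ∑ᶠ y, g y = ∑ᶠ z : X × Y, f z.1 * g z.2 := by
  rw [finsum_curry, finsum_mul' _ _ hf]
  · exact finsum_congr fun x => mul_finsum' _ _ hg
  · exact (hf.prod hg).subset fun z hz =>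
      ⟨fun h => hz (by simp only [h, zero_mul]), fun h => hz (by simp only [h, mul_zero])⟩

end Finsum

section StrongSum

variable {J J' : Type*}

/-- `L = ∑ⱼ fⱼ` in the sense of Hahn series: the supports have a small union and each
coefficient of `L` is a finite sum of coefficients of the `fⱼ`. -/
structure HasStrongSum (f : J → PsiDO n k) (L : PsiDO n k) : Prop where
  isSmall : IsSmall (⋃ j, Function.support (scalarCoeff (f j)))
  finite : ∀ p, (Function.support fun j => scalarCoeff (f j) p).Finite
  scalarCoeff_eq : ∀ p, scalarCoeff L p = ∑ᶠ j, scalarCoeff (f j) p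

theorem HasStrongSum.unique {f : J → PsiDO n k} {L L' : PsiDO n k} (h : HasStrongSum f L)
    (h' : HasStrongSum f L') : L = L' :=
  scalarCoeff_injective (funext fun p => (h.scalarCoeff_eq p).trans (h'.scalarCoeff_eq p).symm)

theorem exists_hasStrongSum {f : J → PsiDO n k}
    (isSmall : IsSmall (⋃ j, Function.support (scalarCoeff (f j))))
    (finite : ∀ p, (Function.support fun j => scalarCoeff (f j) p).Finite) :
    ∃ L, HasStrongSum f L := by
  obtain ⟨L, hL⟩ := exists_scalarCoeff_eq (fun p => ∑ᶠ j, scalarCoeff (f j) p) <|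
    isSmall.mono fun p hp => by
      by_contra hnot
      simp only [Set.mem_iUnion, Function.mem_support, not_exists, not_not] at hnot
      exact hp (finsum_eq_zero_of_forall_eq_zero hnot)
  exact ⟨L, isSmall, finite, congrFun hL⟩

theorem hasStrongSum_const (L : PsiDO n k) : HasStrongSum (fun _ : Unit => L) L where
  isSmall := by simpa only [Set.iUnion_const] using isSmall_support_scalarCoeff L
  finite _ := Set.toFinite _
  scalarCoeff_eq p := by rw [finsum_eq_sum_of_fintype, Fintype.sum_unique]

theorem HasStrongSum.comp_equiv {f : J → PsiDO n k} {L : PsiDO n k} (h : HasStrongSum f L)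
    (e : J' ≃ J) : HasStrongSum (fun j => f (e j)) L where
  isSmall := by
    rw [e.surjective.iUnion_comp fun j => Function.support (scalarCoeff (f j))]
    exact h.isSmall
  finite p := (h.finite p).preimage e.injective.injOn
  scalarCoeff_eq p := by rw [h.scalarCoeff_eq, ← finsum_comp_equiv e]

theorem HasStrongSum.residue_eq {f : J → PsiDO n k} {L : PsiDO n k} (h : HasStrongSum f L) :
    residue L = ∑ᶠ j, residue (f j) :=
  h.scalarCoeff_eq (-1)

theorem HasStrongSum.finite_support_mul {f : J → PsiDO n k} {f' : J' → PsiDO n k}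
    {L L' : PsiDO n k} (h : HasStrongSum f L) (h' : HasStrongSum f' L') (s : Bideg n) :
    (Function.support fun w : (J × J') × (Bideg n × (Fin n → ℕ)) =>
      (leibnizCoeff w.2.1 (s - w.2.1 + diag w.2.2) w.2.2 : k) *
        (scalarCoeff (f w.1.1) w.2.1 *
          scalarCoeff (f' w.1.2) (s - w.2.1 + diag w.2.2))).Finite := by
  refine ((h.isSmall.finite_leibniz h'.isSmall s).biUnion fun z _ =>
    ((h.finite z.1).prod (h'.finite (s - z.1 + diag z.2))).prod
      (Set.finite_singleton z)).subset ?_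
  rintro ⟨⟨j, j'⟩, z⟩ hw
  obtain ⟨hj, hj'⟩ := mul_ne_zero_iff.mp (right_ne_zero_of_mul hw)
  exact Set.mem_biUnion ⟨Set.mem_iUnion_of_mem j hj, Set.mem_iUnion_of_mem j' hj'⟩
    ⟨⟨hj, hj'⟩, rfl⟩

theorem HasStrongSum.mul {f : J → PsiDO n k} {f' : J' → PsiDO n k} {L L' : PsiDO n k}
    (h : HasStrongSum f L) (h' : HasStrongSum f' L') :
    HasStrongSum (fun z : J × J' => f z.1 * f' z.2) (L * L') where
  isSmall := by
    refine (h.isSmall.add (h'.isSmall.add isSmall_range_neg_diag)).mono ?_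
    refine Set.iUnion_subset fun z s hs => ?_
    obtain ⟨p, q, γ, hp, hq, rfl⟩ := exists_of_scalarCoeff_mul_ne_zero hs
    exact ⟨p, Set.mem_iUnion_of_mem z.1 hp, _, ⟨q, Set.mem_iUnion_of_mem z.2 hq, _, ⟨γ, rfl⟩, rfl⟩,
      by simp only [sub_eq_add_neg, add_assoc]⟩
  finite s := by
    refine ((h.finite_support_mul h' s).image Prod.fst).subset fun z hz => ?_
    by_contra hnot
    refine hz ((scalarCoeff_mul _ _ s).trans (finsum_eq_zero_of_forall_eq_zero fun w => ?_))
    exact not_not.mp fun hw => hnot ⟨(z, w), hw, rfl⟩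
  scalarCoeff_eq s := by
    simp only [scalarCoeff_mul]
    rw [finsum_finsum_comm _ (h.finite_support_mul h' s)]
    refine finsum_congr fun z => ?_
    rw [h.scalarCoeff_eq, h'.scalarCoeff_eq,
      finsum_mul_finsum _ _ (h.finite z.1) (h'.finite _), mul_finsum]

end StrongSum

section Ring

theorem leibnizCoeff_zero (p q : Bideg n) : leibnizCoeff p q 0 = 1 :=
  Finset.prod_eq_one fun i _ => leibnizWeight_zero (p.2 i) (q.1 i)

theorem leibnizCoeff_eq_zero_of_left {p : Bideg n} (hp : p.2 = 0) (q : Bideg n) {γ : Fin n → ℕ}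
    (hγ : γ ≠ 0) : leibnizCoeff p q γ = 0 := by
  obtain ⟨i, hi⟩ := Function.ne_iff.mp hγ
  refine Finset.prod_eq_zero (Finset.mem_univ i) ?_
  rw [hp]
  exact leibnizWeight_zero_left _ hi

theorem leibnizCoeff_eq_zero_of_right (p : Bideg n) {q : Bideg n} (hq : q.1 = 0) {γ : Fin n → ℕ}
    (hγ : γ ≠ 0) : leibnizCoeff p q γ = 0 := by
  obtain ⟨i, hi⟩ := Function.ne_iff.mp hγ
  refine Finset.prod_eq_zero (Finset.mem_univ i) ?_
  rw [leibnizWeight_comm, hq]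
  exact leibnizWeight_zero_left _ hi

theorem scalarCoeff_monomial_self (p : Bideg n) : scalarCoeff (monomial p : PsiDO n k) p = 1 := by
  classical rw [scalarCoeff_monomial, Pi.single_eq_same]

theorem scalarCoeff_monomial_of_ne {p q : Bideg n} (h : q ≠ p) :
    scalarCoeff (monomial p : PsiDO n k) q = 0 := by
  classical rw [scalarCoeff_monomial, Pi.single_eq_of_ne h]

theorem eq_of_scalarCoeff_monomial_ne_zero {p q : Bideg n}
    (h : scalarCoeff (monomial p : PsiDO n k) q ≠ 0) : q = p :=
  by_contra fun hne => h (scalarCoeff_monomial_of_ne hne)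

theorem scalarCoeff_monomial_mul (p : Bideg n) (M : PsiDO n k) (s : Bideg n) :
    scalarCoeff (monomial p * M) s = ∑ᶠ γ : Fin n → ℕ,
      (leibnizCoeff p (s - p + diag γ) γ : k) * scalarCoeff M (s - p + diag γ) := by
  rw [scalarCoeff_mul, finsum_curry _ (finite_support_mul _ M s), finsum_eq_single _ p]
  · simp only [scalarCoeff_monomial_self, one_mul]
  · intro q hq
    simp only [scalarCoeff_monomial_of_ne hq, zero_mul, mul_zero, finsum_zero]

theorem scalarCoeff_mul_monomial (L : PsiDO n k) (r s : Bideg n) :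
    scalarCoeff (L * monomial r) s = ∑ᶠ γ : Fin n → ℕ,
      (leibnizCoeff (s - r + diag γ) r γ : k) * scalarCoeff L (s - r + diag γ) := by
  rw [scalarCoeff_mul, finsum_curry _ (finite_support_mul L _ s),
    finsum_finsum_comm _ (finite_support_mul L _ s)]
  refine finsum_congr fun γ => ?_
  have hr : s - (s - r + diag γ) + diag γ = r := by abel
  rw [finsum_eq_single _ (s - r + diag γ), hr, scalarCoeff_monomial_self, mul_one]
  intro p hp
  rw [scalarCoeff_monomial_of_ne, mul_zero, mul_zero]
  rintro rfl
  exact hp (by abel)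

theorem scalarCoeff_monomial_mul_of_snd_eq_zero {p : Bideg n} (hp : p.2 = 0) (M : PsiDO n k)
    (s : Bideg n) : scalarCoeff (monomial p * M) s = scalarCoeff M (s - p) := by
  rw [scalarCoeff_monomial_mul, finsum_eq_single _ 0, leibnizCoeff_zero, Int.cast_one, one_mul,
    map_zero, add_zero]
  intro γ hγ
  rw [leibnizCoeff_eq_zero_of_left hp _ hγ, Int.cast_zero, zero_mul]

theorem scalarCoeff_mul_monomial_of_fst_eq_zero (L : PsiDO n k) {r : Bideg n} (hr : r.1 = 0)
    (s : Bideg n) : scalarCoeff (L * monomial r) s = scalarCoeff L (s - r) := by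
  rw [scalarCoeff_mul_monomial, finsum_eq_single _ 0, leibnizCoeff_zero, Int.cast_one, one_mul,
    map_zero, add_zero]
  intro γ hγ
  rw [leibnizCoeff_eq_zero_of_right _ hr hγ, Int.cast_zero, zero_mul]

theorem scalarCoeff_monomial_mul_monomial (p q : Bideg n) (γ : Fin n → ℕ) :
    scalarCoeff (monomial p * monomial q : PsiDO n k) (p + q - diag γ) = leibnizCoeff p q γ := by
  have hq (γ' : Fin n → ℕ) : p + q - diag γ - p + diag γ' = q ↔ γ' = γ := by
    rw [← diag_injective.eq_iff, ← sub_eq_zero, ← sub_eq_zero (a := diag γ')]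
    exact iff_of_eq (congrArg (· = 0) (by abel))
  rw [scalarCoeff_monomial_mul, finsum_eq_single _ γ, (hq γ).mpr rfl, scalarCoeff_monomial_self,
    mul_one]
  intro γ' hγ'
  rw [scalarCoeff_monomial_of_ne (mt (hq γ').mp hγ'), mul_zero]

theorem sum_Iic_prod_eq_prod_sum_antidiagonal {R : Type*} [CommSemiring R]
    (f : Fin n → ℕ × ℕ → R) (Γ : Fin n → ℕ) :
    ∑ γ ∈ Finset.Iic Γ, ∏ i, f i (Γ i - γ i, γ i) =
      ∏ i, ∑ x ∈ Finset.HasAntidiagonal.antidiagonal (Γ i), f i x := by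
  have sum_antidiagonal (i : Fin n) : ∑ x ∈ Finset.HasAntidiagonal.antidiagonal (Γ i), f i x =
      ∑ g ∈ Finset.Iic (Γ i), f i (Γ i - g, g) := by
    rw [← Finset.Nat.sum_antidiagonal_swap, Finset.Nat.sum_antidiagonal_eq_sum_range_succ_mk,
      Nat.range_succ_eq_Iic]
    rfl
  rw [Finset.prod_congr rfl fun i _ => sum_antidiagonal i, Finset.prod_univ_sum]
  rfl

theorem leibnizCoeff_assoc (p q r : Bideg n) (Γ : Fin n → ℕ) :
    ∑ γ ∈ Finset.Iic Γ, leibnizCoeff p q (Γ - γ) * leibnizCoeff (p + q - diag (Γ - γ)) r γ =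
      ∑ γ ∈ Finset.Iic Γ, leibnizCoeff q r (Γ - γ) * leibnizCoeff p (q + r - diag (Γ - γ)) γ := by
  simp only [leibnizCoeff, ← Finset.prod_mul_distrib]
  refine (sum_Iic_prod_eq_prod_sum_antidiagonal (fun i x => leibnizWeight (p.2 i) (q.1 i) x.1 *
    leibnizWeight (p.2 i + q.2 i - x.1) (r.1 i) x.2) Γ).trans ?_
  refine Eq.trans ?_ (sum_Iic_prod_eq_prod_sum_antidiagonal (fun i x =>
    leibnizWeight (q.2 i) (r.1 i) x.1 * leibnizWeight (p.2 i) (q.1 i + r.1 i - x.1) x.2) Γ).symm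
  exact Finset.prod_congr rfl fun i _ => sum_leibnizWeight_mul_leibnizWeight _ _ _ _ _

theorem exists_of_scalarCoeff_monomial_mul_monomial_ne_zero {p q s : Bideg n}
    (h : scalarCoeff (monomial p * monomial q : PsiDO n k) s ≠ 0) : ∃ γ, p + q - diag γ = s := by
  obtain ⟨_, _, γ, hp, hq, rfl⟩ := exists_of_scalarCoeff_mul_ne_zero h
  exact ⟨γ, by rw [eq_of_scalarCoeff_monomial_ne_zero hp, eq_of_scalarCoeff_monomial_ne_zero hq]⟩

theorem le_of_scalarCoeff_monomial_mul_monomial_ne_zero {p q : Bideg n} {γ Γ : Fin n → ℕ}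
    (h : scalarCoeff (monomial p * monomial q : PsiDO n k) (p + q - diag Γ + diag γ) ≠ 0) :
    γ ≤ Γ := by
  obtain ⟨γ', hγ'⟩ := exists_of_scalarCoeff_monomial_mul_monomial_ne_zero h
  have hΓ : diag Γ = diag (γ + γ') := by
    rw [map_add]
    linear_combination hγ'
  rw [diag_injective hΓ]
  exact le_self_add

theorem add_sub_diag_add_diag (p : Bideg n) {γ Γ : Fin n → ℕ} (h : γ ≤ Γ) :
    p - diag Γ + diag γ = p - diag (Γ - γ) := by
  rw [← tsub_add_cancel_of_le h, map_add, add_tsub_cancel_right]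
  abel

theorem scalarCoeff_monomial_mul_monomial_mul_monomial (p q r : Bideg n) (Γ : Fin n → ℕ) :
    scalarCoeff (monomial p * monomial q * monomial r : PsiDO n k) (p + q + r - diag Γ) =
      (∑ γ ∈ Finset.Iic Γ,
        leibnizCoeff p q (Γ - γ) * leibnizCoeff (p + q - diag (Γ - γ)) r γ : ℤ) := by
  have hs (γ : Fin n → ℕ) : p + q + r - diag Γ - r + diag γ = p + q - diag Γ + diag γ := by abel
  rw [scalarCoeff_mul_monomial]
  simp only [hs]
  rw [Int.cast_sum, finsum_eq_sum_of_support_subset (s := Finset.Iic Γ)]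
  · refine Finset.sum_congr rfl fun γ hγ => ?_
    rw [add_sub_diag_add_diag _ (Finset.mem_Iic.mp hγ), scalarCoeff_monomial_mul_monomial,
      Int.cast_mul, mul_comm]
  · exact fun γ hγ => Finset.mem_coe.mpr (Finset.mem_Iic.mpr
      (le_of_scalarCoeff_monomial_mul_monomial_ne_zero (right_ne_zero_of_mul hγ)))

theorem scalarCoeff_monomial_mul_monomial_mul_monomial' (p q r : Bideg n) (Γ : Fin n → ℕ) :
    scalarCoeff (monomial p * (monomial q * monomial r) : PsiDO n k) (p + q + r - diag Γ) =
      (∑ γ ∈ Finset.Iic Γ,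
        leibnizCoeff q r (Γ - γ) * leibnizCoeff p (q + r - diag (Γ - γ)) γ : ℤ) := by
  have hs (γ : Fin n → ℕ) : p + q + r - diag Γ - p + diag γ = q + r - diag Γ + diag γ := by abel
  rw [scalarCoeff_monomial_mul]
  simp only [hs]
  rw [Int.cast_sum, finsum_eq_sum_of_support_subset (s := Finset.Iic Γ)]
  · refine Finset.sum_congr rfl fun γ hγ => ?_
    rw [add_sub_diag_add_diag _ (Finset.mem_Iic.mp hγ), scalarCoeff_monomial_mul_monomial,
      Int.cast_mul, mul_comm]
  · exact fun γ hγ => Finset.mem_coe.mpr (Finset.mem_Iic.mpr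
      (le_of_scalarCoeff_monomial_mul_monomial_ne_zero (right_ne_zero_of_mul hγ)))

theorem monomial_mul_assoc (p q r : Bideg n) :
    (monomial p * monomial q * monomial r : PsiDO n k) =
      monomial p * (monomial q * monomial r) := by
  refine scalarCoeff_injective (funext fun s => ?_)
  by_cases hs : ∃ Γ, s = p + q + r - diag Γ
  · obtain ⟨Γ, rfl⟩ := hs
    rw [scalarCoeff_monomial_mul_monomial_mul_monomial,
      scalarCoeff_monomial_mul_monomial_mul_monomial', leibnizCoeff_assoc]
  · have hleft : scalarCoeff (monomial p * monomial q * monomial r : PsiDO n k) s = 0 := by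
      by_contra h
      obtain ⟨_, _, γ, hpq, hr, rfl⟩ := exists_of_scalarCoeff_mul_ne_zero h
      obtain ⟨γ', rfl⟩ := exists_of_scalarCoeff_monomial_mul_monomial_ne_zero hpq
      refine hs ⟨γ' + γ, ?_⟩
      rw [eq_of_scalarCoeff_monomial_ne_zero hr, map_add]
      abel
    have hright : scalarCoeff (monomial p * (monomial q * monomial r) : PsiDO n k) s = 0 := by
      by_contra h
      obtain ⟨_, _, γ, hp, hqr, rfl⟩ := exists_of_scalarCoeff_mul_ne_zero h
      obtain ⟨γ', rfl⟩ := exists_of_scalarCoeff_monomial_mul_monomial_ne_zero hqr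
      refine hs ⟨γ' + γ, ?_⟩
      rw [eq_of_scalarCoeff_monomial_ne_zero hp, map_add]
      abel
    rw [hleft, hright]

theorem hasStrongSum_monomial (L : PsiDO n k) :
    HasStrongSum (fun p => scalarCoeff L p • monomial p) L := by
  have scalarCoeff_term (p q : Bideg n) (h : q ≠ p) :
      scalarCoeff (scalarCoeff L p • monomial p : PsiDO n k) q = 0 := by
    rw [scalarCoeff_smul, Pi.smul_apply, scalarCoeff_monomial_of_ne h, smul_zero]
  refine ⟨(isSmall_support_scalarCoeff L).mono (Set.iUnion_subset fun p q hq => ?_),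
    fun q => (Set.finite_singleton q).subset fun p hp => ?_, fun q => ?_⟩
  · obtain rfl : q = p := not_not.mp fun hne => hq (scalarCoeff_term p q hne)
    exact left_ne_zero_of_mul hq
  · exact not_not.mp fun hne => hp (scalarCoeff_term p q (Ne.symm hne))
  · rw [finsum_eq_single _ q fun p hp => scalarCoeff_term p q hp.symm, scalarCoeff_smul,
      Pi.smul_apply, scalarCoeff_monomial_self, smul_eq_mul, mul_one]

protected theorem mul_assoc (L M N : PsiDO n k) : L * M * N = L * (M * N) := by
  have hL := hasStrongSum_monomial L
  have hM := hasStrongSum_monomial M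
  have hN := hasStrongSum_monomial N
  refine ((hL.mul hM).mul hN).unique ?_
  convert (hL.mul (hM.mul hN)).comp_equiv (Equiv.prodAssoc _ _ _) using 2 with z
  simp only [PsiDO.smul_mul_assoc, PsiDO.mul_smul_comm, monomial_mul_assoc,
    Equiv.prodAssoc_apply]

noncomputable instance : Ring (PsiDO n k) where
  left_distrib := PsiDO.mul_add
  right_distrib := PsiDO.add_mul
  zero_mul L := by simpa only [zero_smul] using PsiDO.smul_mul_assoc 0 0 L
  mul_zero L := by simpa only [zero_smul] using PsiDO.mul_smul_comm 0 L 0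
  mul_assoc := PsiDO.mul_assoc
  one_mul L := by
    refine scalarCoeff_injective (funext fun s => ?_)
    rw [one_eq_monomial, scalarCoeff_monomial_mul_of_snd_eq_zero rfl, sub_zero]
  mul_one L := by
    refine scalarCoeff_injective (funext fun s => ?_)
    rw [one_eq_monomial, scalarCoeff_mul_monomial_of_fst_eq_zero _ rfl, sub_zero]
  neg_add_cancel := neg_add_cancel
  zsmul := zsmulRec
  sub_eq_add_neg := sub_eq_add_neg

noncomputable instance : Algebra k (PsiDO n k) :=
  Algebra.ofModule PsiDO.smul_mul_assoc PsiDO.mul_smul_comm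

end Ring

section Residue

theorem residue_zero : residue (0 : PsiDO n k) = 0 := rfl

theorem residue_add (L M : PsiDO n k) : residue (L + M) = residue L + residue M := rfl

theorem residue_sub (L M : PsiDO n k) : residue (L - M) = residue L - residue M :=
  (AddMonoidHom.mk' (residue (n := n) (k := k)) residue_add).map_sub L M

theorem residue_smul (c : k) (L : PsiDO n k) : residue (c • L) = c * residue L := rfl

theorem leibnizCoeff_reflect (p : Bideg n) (γ : Fin n → ℕ) :
    leibnizCoeff p (-1 - p + diag γ) γ = leibnizCoeff (-1 - p + diag γ) p γ := by
  refine Finset.prod_congr rfl fun i _ => ?_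
  have reflect (a : ℤ) : -1 - a + (γ i : ℤ) = γ i - 1 - a := by ring
  refine (congrArg (leibnizWeight _ · _) (reflect _)).trans ?_
  exact (leibnizWeight_reflect _ _ _).trans (congrArg (leibnizWeight · _ _) (reflect _).symm)

theorem residue_mul_comm (L M : PsiDO n k) : residue (L * M) = residue (M * L) := by
  have reflect_reflect (z : Bideg n × (Fin n → ℕ)) :
      -1 - (-1 - z.1 + diag z.2) + diag z.2 = z.1 := by abel
  have involutive_reflect : Function.Involutive fun z : Bideg n × (Fin n → ℕ) =>
      (-1 - z.1 + diag z.2, z.2) := fun z => Prod.ext (reflect_reflect z) rfl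
  rw [residue_eq_scalarCoeff, residue_eq_scalarCoeff, scalarCoeff_mul, scalarCoeff_mul,
    ← finsum_comp_equiv involutive_reflect.toPerm]
  refine finsum_congr fun z => ?_
  dsimp only [Function.Involutive.coe_toPerm]
  rw [reflect_reflect, leibnizCoeff_reflect, mul_comm (scalarCoeff L _)]

/-- The operator dual to the monomial with exponents `p = (a, α)` under the residue pairing. The
powers of `∂` stand on the left, so that shifting exponents computes the pairing. -/
noncomputable def dualMonomial (p : Bideg n) : PsiDO n k :=
  monomial (0, -1 - p.2) * monomial (-1 - p.1, 0)

theorem residue_mul_dualMonomial (L : PsiDO n k) (p : Bideg n) :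
    residue (L * dualMonomial p) = scalarCoeff L p := by
  have shift : (-1 - (-1 - p.1, 0) - (0, -1 - p.2) : Bideg n) = p := by
    ext i <;> simp
  rw [dualMonomial, ← mul_assoc, residue_mul_comm, residue_eq_scalarCoeff,
    scalarCoeff_monomial_mul_of_snd_eq_zero rfl, scalarCoeff_mul_monomial_of_fst_eq_zero _ rfl,
    shift]

theorem eq_of_residue_mul_eq {U V : PsiDO n k} (h : ∀ M, residue (M * U) = residue (M * V)) :
    U = V := by
  refine scalarCoeff_injective (funext fun p => ?_)
  rw [← residue_mul_dualMonomial, residue_mul_comm, h, residue_mul_comm, residue_mul_dualMonomial]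

theorem exists_of_scalarCoeff_dualMonomial_ne_zero {p q : Bideg n}
    (h : scalarCoeff (dualMonomial p : PsiDO n k) q ≠ 0) : ∃ γ, -1 - p - diag γ = q := by
  obtain ⟨γ, rfl⟩ := exists_of_scalarCoeff_monomial_mul_monomial_ne_zero h
  refine ⟨γ, congrArg (· - diag γ) ?_⟩
  ext i <;> simp

theorem isSmall_of_finite_mul_scalarCoeff {D : Bideg n → k}
    (hD : ∀ M : PsiDO n k, {p | D p * scalarCoeff M p ≠ 0}.Finite) :
    IsSmall {p | -1 - p ∈ Function.support D} := by
  classical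
  refine isSmall_of_finite_inter _ _ fun T hT => ?_
  obtain ⟨M, hM⟩ := exists_scalarCoeff_eq (k := k) (T.indicator 1)
    (hT.mono Set.support_indicator_subset)
  refine (hD M).subset fun p hp => mul_ne_zero hp.1 ?_
  rw [hM, Set.indicator_of_mem hp.2]
  exact one_ne_zero

theorem exists_hasStrongSum_smul_dualMonomial {D : Bideg n → k}
    (hD : IsSmall {p | -1 - p ∈ Function.support D}) :
    ∃ U, HasStrongSum (fun p => D p • (dualMonomial p : PsiDO n k)) U := by
  have exists_of_ne_zero {p q : Bideg n}
      (h : scalarCoeff (D p • (dualMonomial p : PsiDO n k)) q ≠ 0) :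
      -1 - (-1 - p) ∈ Function.support D ∧ ∃ γ, -diag γ = q - (-1 - p) := by
    rw [scalarCoeff_smul, Pi.smul_apply, smul_eq_mul] at h
    obtain ⟨γ, rfl⟩ := exists_of_scalarCoeff_dualMonomial_ne_zero (right_ne_zero_of_mul h)
    rw [sub_sub_cancel]
    exact ⟨left_ne_zero_of_mul h, γ, by abel⟩
  refine exists_hasStrongSum ?_ fun q => ?_
  · refine (hD.add isSmall_range_neg_diag).mono (Set.iUnion_subset fun p q hq => ?_)
    obtain ⟨hp, hγ⟩ := exists_of_ne_zero hq
    exact ⟨-1 - p, hp, q - (-1 - p), hγ, add_sub_cancel _ _⟩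
  · exact ((hD.finite_inter_sub isSmall_range_neg_diag q).preimage
      (sub_right_injective (b := (-1 : Bideg n))).injOn).subset fun p hp => exists_of_ne_zero hp

theorem exists_residue_mul_eq {D : Bideg n → k}
    (hD : ∀ M : PsiDO n k, {p | D p * scalarCoeff M p ≠ 0}.Finite) :
    ∃ U : PsiDO n k, ∀ M, residue (M * U) = ∑ᶠ p, D p * scalarCoeff M p := by
  obtain ⟨U, hU⟩ := exists_hasStrongSum_smul_dualMonomial (isSmall_of_finite_mul_scalarCoeff hD)
  refine ⟨U, fun M => ?_⟩
  have hMU := ((hasStrongSum_const M).mul hU).comp_equiv (Equiv.punitProd (Bideg n)).symm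
  refine hMU.residue_eq.trans (finsum_congr fun p => ?_)
  rw [Equiv.punitProd_symm_apply, mul_smul_comm, residue_smul, residue_mul_dualMonomial]

end Residue

section Pairing

theorem pairing_single_left [DecidableEq (Fin n)] (i : Fin n) (M : PsiDO n k)
    (U : Fin n → PsiDO n k) : pairing (Pi.single i M) U = residue (M * U i) := by
  rw [pairing, Fintype.sum_eq_single i, Pi.single_eq_same]
  intro j hj
  rw [Pi.single_eq_of_ne hj, zero_mul, residue_zero]

theorem eq_of_pairing_eq {U V : Fin n → PsiDO n k} (h : ∀ M, pairing M U = pairing M V) :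
    U = V := by
  classical
  refine funext fun i => eq_of_residue_mul_eq fun M => ?_
  rw [← pairing_single_left, h, pairing_single_left]

theorem exists_pairing_eq {D : CoordIndex n → k}
    (hD : ∀ M : Fin n → PsiDO n k, {v | D v * coord M v ≠ 0}.Finite) :
    ∃ U : Fin n → PsiDO n k, ∀ M, pairing M U = ∑ᶠ v, D v * coord M v := by
  have exists_component (i : Fin n) :
      ∃ U : PsiDO n k, ∀ M, residue (M * U) = ∑ᶠ p, D (i, p) * scalarCoeff M p :=
    exists_residue_mul_eq fun M => (hD fun _ => M).preimage (Prod.mk_right_injective i).injOn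
  choose U hU using exists_component
  refine ⟨U, fun M => ?_⟩
  rw [finsum_curry _ (hD M), finsum_eq_sum_of_fintype]
  exact Finset.sum_congr rfl fun i _ => hU i (M i)

end Pairing

section Gradient

open Polynomial in
/-- The restriction of the monomial `c m · ∏ v^{m v}` to the line `L + ε M`, a polynomial in `ε`. -/
noncomputable def linePoly (c : (CoordIndex n →₀ ℕ) → k) (L M : Fin n → PsiDO n k)
    (m : CoordIndex n →₀ ℕ) : Polynomial k :=
  C (c m) * m.prod fun v e => (C (coord L v) + X * C (coord M v)) ^ e

theorem eval_linePoly (c : (CoordIndex n →₀ ℕ) → k) (L M : Fin n → PsiDO n k)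
    (m : CoordIndex n →₀ ℕ) (ε : k) :
    (linePoly c L M m).eval ε = monomialValue c (L + ε • M) m := by
  simp only [linePoly, Finsupp.prod, Polynomial.eval_mul, Polynomial.eval_C, Polynomial.eval_prod,
    Polynomial.eval_pow, Polynomial.eval_add, Polynomial.eval_X]
  rfl

open Polynomial in
theorem natDegree_linePoly_le (c : (CoordIndex n →₀ ℕ) → k) (L M : Fin n → PsiDO n k)
    (m : CoordIndex n →₀ ℕ) : (linePoly c L M m).natDegree ≤ m.degree := by
  refine (natDegree_C_mul_le _ _).trans ((natDegree_prod_le _ _).trans ?_)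
  refine Finset.sum_le_sum fun v _ => natDegree_pow_le.trans ?_
  exact mul_le_of_le_one_right (Nat.zero_le _) (by compute_degree)

theorem finite_support_linePoly [Infinite k] {c : (CoordIndex n →₀ ℕ) → k} {N : ℕ}
    (hN : ∀ m, c m ≠ 0 → m.degree ≤ N)
    (hc : ∀ L : Fin n → PsiDO n k, (Function.support (monomialValue c L)).Finite)
    (L M : Fin n → PsiDO n k) : (Function.support (linePoly c L M)).Finite := by
  -- A polynomial of degree at most `N` that vanishes at `N + 1` points is zero.
  let ε : Fin (N + 1) → k := fun j => Infinite.natEmbedding k j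
  have ε_injective : Function.Injective ε :=
    (Infinite.natEmbedding k).injective.comp Fin.val_injective
  refine (Set.finite_iUnion fun j => hc (L + ε j • M)).subset fun m hm => ?_
  by_contra hvanish
  simp only [Set.mem_iUnion, Function.mem_support, not_exists, not_not] at hvanish
  have hcm : c m ≠ 0 := fun h => hm (by rw [linePoly, h, Polynomial.C_0, zero_mul])
  refine hm (Polynomial.eq_zero_of_natDegree_lt_card_of_eval_eq_zero _ ε_injective
    (fun j => (eval_linePoly c L M m (ε j)).trans (hvanish j)) ?_)
  rw [Fintype.card_fin]
  exact Nat.lt_succ_of_le ((natDegree_linePoly_le c L M m).trans (hN m hcm))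

/-- The value at `L` of the derivative of the monomial `c m · ∏ v^{m v}` with respect to `v`. -/
noncomputable def monomialDeriv (c : (CoordIndex n →₀ ℕ) → k) (L : Fin n → PsiDO n k)
    (m : CoordIndex n →₀ ℕ) (v : CoordIndex n) : k :=
  c m * ((∏ w ∈ m.support.erase v, coord L w ^ m w) * (m v * coord L v ^ (m v - 1)))

theorem monomialDeriv_eq_zero (c : (CoordIndex n →₀ ℕ) → k) (L : Fin n → PsiDO n k)
    {m : CoordIndex n →₀ ℕ} {v : CoordIndex n} (hv : v ∉ m.support) :
    monomialDeriv c L m v = 0 := by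
  rw [monomialDeriv, Finsupp.notMem_support_iff.mp hv, Nat.cast_zero, zero_mul, mul_zero, mul_zero]

theorem eval_derivative_linePoly (c : (CoordIndex n →₀ ℕ) → k) (L M : Fin n → PsiDO n k)
    (m : CoordIndex n →₀ ℕ) :
    (linePoly c L M m).derivative.eval 0 = ∑ᶠ v, monomialDeriv c L m v * coord M v := by
  rw [finsum_eq_sum_of_support_subset (s := m.support)]
  · simp only [linePoly, Finsupp.prod, Polynomial.derivative_C_mul,
      Polynomial.derivative_prod_finset, Polynomial.eval_mul, Polynomial.eval_C,
      Polynomial.eval_finsetSum, Finset.mul_sum]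
    refine Finset.sum_congr rfl fun v _ => ?_
    simp only [Polynomial.eval_prod, Polynomial.derivative_pow, Polynomial.eval_mul,
      Polynomial.eval_pow, Polynomial.eval_add, Polynomial.eval_C, Polynomial.eval_X,
      Polynomial.derivative_add, Polynomial.derivative_C, Polynomial.derivative_X,
      Polynomial.derivative_mul, monomialDeriv, zero_mul, add_zero, mul_zero, zero_add, one_mul]
    ring
  · intro v hv
    by_contra h
    exact left_ne_zero_of_mul hv (monomialDeriv_eq_zero c L h)

theorem linePoly_ne_zero {c : (CoordIndex n →₀ ℕ) → k} {L M : Fin n → PsiDO n k}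
    {m : CoordIndex n →₀ ℕ} {v : CoordIndex n} (h : monomialDeriv c L m v * coord M v ≠ 0) :
    linePoly c L M m ≠ 0 := by
  obtain ⟨hderiv, hM⟩ := mul_ne_zero_iff.mp h
  obtain ⟨hc, hprod⟩ := mul_ne_zero_iff.mp hderiv
  have hpow := Finset.prod_ne_zero_iff.mp (left_ne_zero_of_mul hprod)
  refine mul_ne_zero (Polynomial.C_ne_zero.mpr hc) (Finset.prod_ne_zero_iff.mpr fun w hw => ?_)
  refine pow_ne_zero _ fun hzero => ?_
  by_cases hwv : w = v
  · have hcoeff := congrArg (Polynomial.coeff · 1) hzero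
    simp only [Polynomial.coeff_add, Polynomial.coeff_C_succ, Polynomial.coeff_X_mul,
      Polynomial.coeff_C_zero, zero_add, Polynomial.coeff_zero] at hcoeff
    exact hM (hwv ▸ hcoeff)
  · have hcoeff := congrArg (Polynomial.coeff · 0) hzero
    simp only [Polynomial.coeff_add, Polynomial.coeff_C_zero, Polynomial.coeff_X_mul_zero,
      add_zero, Polynomial.coeff_zero] at hcoeff
    refine hpow w (Finset.mem_erase.mpr ⟨hwv, hw⟩) ?_
    rw [hcoeff, zero_pow (Finsupp.mem_support_iff.mp hw)]

theorem finite_support_monomialDeriv {c : (CoordIndex n →₀ ℕ) → k} {L M : Fin n → PsiDO n k}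
    (h : (Function.support (linePoly c L M)).Finite) :
    (Function.support fun z : (CoordIndex n →₀ ℕ) × CoordIndex n =>
      monomialDeriv c L z.1 z.2 * coord M z.2).Finite := by
  refine (h.biUnion fun m _ => (Set.finite_singleton m).prod m.support.finite_toSet).subset ?_
  rintro ⟨m, v⟩ hz
  refine Set.mem_biUnion (linePoly_ne_zero hz) ⟨rfl, ?_⟩
  by_contra hv
  exact left_ne_zero_of_mul hz (monomialDeriv_eq_zero c L hv)

theorem hasDerivAlong_of_linePoly {F : (Fin n → PsiDO n k) → k} {c : (CoordIndex n →₀ ℕ) → k}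
    (hF : ∀ L, F L = ∑ᶠ m, monomialValue c L m) {L M : Fin n → PsiDO n k}
    (h : (Function.support (linePoly c L M)).Finite) :
    HasDerivAlong F L M (∑ᶠ v, (∑ᶠ m, monomialDeriv c L m v) * coord M v) := by
  refine ⟨∑ᶠ m, linePoly c L M m, fun ε => ?_, ?_⟩
  · rw [hF, ← Polynomial.coe_evalRingHom]
    refine (finsum_congr fun m => (eval_linePoly c L M m ε).symm).trans ?_
    exact ((Polynomial.evalRingHom ε).toAddMonoidHom.map_finsum h).symm
  · calc (Polynomial.derivative (∑ᶠ m, linePoly c L M m)).eval 0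
        = ∑ᶠ m, (linePoly c L M m).derivative.eval 0 :=
          ((Polynomial.evalRingHom 0).toAddMonoidHom.comp
            Polynomial.derivative.toAddMonoidHom).map_finsum h
      _ = ∑ᶠ m, ∑ᶠ v, monomialDeriv c L m v * coord M v :=
          finsum_congr fun m => eval_derivative_linePoly c L M m
      _ = ∑ᶠ v, ∑ᶠ m, monomialDeriv c L m v * coord M v :=
          finsum_finsum_comm _ (finite_support_monomialDeriv h)
      _ = ∑ᶠ v, (∑ᶠ m, monomialDeriv c L m v) * coord M v :=
          finsum_congr fun v => (finsum_mul _ _).symm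

theorem exists_isGradient [Infinite k] {F : (Fin n → PsiDO n k) → k} (hF : F ∈ functionals n k)
    (L : Fin n → PsiDO n k) : ∃ U, IsGradient F L U := by
  obtain ⟨c, ⟨N, hN⟩, hc⟩ := hF
  have hfinite := finite_support_linePoly hN (fun L => (hc L).1) L
  obtain ⟨U, hU⟩ := exists_pairing_eq (D := fun v => ∑ᶠ m, monomialDeriv c L m v) fun M => by
    refine ((finite_support_monomialDeriv (hfinite M)).image Prod.snd).subset fun v hv => ?_
    by_contra hnot
    refine hv ((finsum_mul _ _).trans (finsum_eq_zero_of_forall_eq_zero fun m => ?_))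
    exact not_not.mp fun hm => hnot ⟨(m, v), hm, rfl⟩
  refine ⟨U, fun M => ?_⟩
  rw [hU]
  exact hasDerivAlong_of_linePoly (fun L => (hc L).2) (hfinite M)

theorem HasDerivAlong.unique [Infinite k] {F : (Fin n → PsiDO n k) → k}
    {L M : Fin n → PsiDO n k} {c d : k} (hc : HasDerivAlong F L M c)
    (hd : HasDerivAlong F L M d) : c = d := by
  obtain ⟨p, hp, rfl⟩ := hc
  obtain ⟨q, hq, rfl⟩ := hd
  rw [Polynomial.funext fun ε => (hp ε).symm.trans (hq ε)]

theorem IsGradient.unique [Infinite k] {F : (Fin n → PsiDO n k) → k} {L U V : Fin n → PsiDO n k}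
    (hU : IsGradient F L U) (hV : IsGradient F L V) : U = V :=
  eq_of_pairing_eq fun M => (hU M).unique (hV M)

theorem IsGradient.gradient_eq [Infinite k] {F : (Fin n → PsiDO n k) → k}
    {L U : Fin n → PsiDO n k} (hU : IsGradient F L U) : gradient F L = U := by
  have hex : ∃ U, IsGradient F L U := ⟨U, hU⟩
  rw [gradient, dif_pos hex]
  exact hex.choose_spec.unique hU

end Gradient

section PolynomialMap

/-- The maps `Pⁿ → P` of the form `L ↦ ∑ⱼ v^{m j}(L) • A j`, a sum that may be infinite, of
monomials of bounded degree in the coordinates `v` with operators as coefficients. -/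
def IsPolynomialMap (Φ : (Fin n → PsiDO n k) → PsiDO n k) : Prop :=
  ∃ (J : Type) (A : J → PsiDO n k) (m : J → CoordIndex n →₀ ℕ),
    (∃ N : ℕ, ∀ j, (m j).degree ≤ N) ∧
    ∀ L, HasStrongSum (fun j => ((m j).prod fun v e => coord L v ^ e) • A j) (Φ L)

theorem isPolynomialMap_one : IsPolynomialMap fun _ : Fin n → PsiDO n k => 1 := by
  refine ⟨Unit, fun _ => 1, fun _ => 0, ⟨0, fun _ => (map_zero Finsupp.degree).le⟩, fun L => ?_⟩
  simp only [Finsupp.prod_zero_index, one_smul]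
  exact hasStrongSum_const 1

theorem isPolynomialMap_apply (i : Fin n) : IsPolynomialMap fun L : Fin n → PsiDO n k => L i := by
  refine ⟨Bideg n, monomial, fun p => Finsupp.single (i, p) 1,
    ⟨1, fun p => (Finsupp.degree_single _ _).le⟩, fun L => ?_⟩
  simp only [Finsupp.prod_single_index, pow_zero, pow_one]
  exact hasStrongSum_monomial (L i)

theorem IsPolynomialMap.mul {Φ Ψ : (Fin n → PsiDO n k) → PsiDO n k} (hΦ : IsPolynomialMap Φ)
    (hΨ : IsPolynomialMap Ψ) : IsPolynomialMap fun L => Φ L * Ψ L := by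
  obtain ⟨J, A, m, ⟨N, hN⟩, hsum⟩ := hΦ
  obtain ⟨J', A', m', ⟨N', hN'⟩, hsum'⟩ := hΨ
  refine ⟨J × J', fun z => A z.1 * A' z.2, fun z => m z.1 + m' z.2,
    ⟨N + N', fun z => ?_⟩, fun L => ?_⟩
  · rw [map_add]
    exact add_le_add (hN _) (hN' _)
  · convert (hsum L).mul (hsum' L) using 2 with z
    rw [Finsupp.prod_add_index' (fun _ => pow_zero _) fun _ _ _ => pow_add _ _ _,
      smul_mul_smul_comm]

theorem isPolynomialMap_prod_map (w : List (Fin n)) :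
    IsPolynomialMap fun L : Fin n → PsiDO n k => (w.map L).prod := by
  induction w with
  | nil => exact isPolynomialMap_one
  | cons i w ih =>
    simp only [List.map_cons, List.prod_cons]
    exact (isPolynomialMap_apply i).mul ih

theorem mem_functionals_of_forall_eq_finsum {J : Type*} {c : J → k}
    {m : J → CoordIndex n →₀ ℕ} {N : ℕ} (hN : ∀ j, (m j).degree ≤ N)
    {F : (Fin n → PsiDO n k) → k}
    (finite : ∀ L, (Function.support fun j => c j * (m j).prod fun v e => coord L v ^ e).Finite)
    (hF : ∀ L, F L = ∑ᶠ j, c j * (m j).prod fun v e => coord L v ^ e) :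
    F ∈ functionals n k := by
  classical
  let d : (CoordIndex n →₀ ℕ) → k := fun μ => ∑ᶠ j, if m j = μ then c j else 0
  refine ⟨d, ⟨N, fun μ hμ => ?_⟩, fun L => ?_⟩
  · by_contra hdeg
    exact hμ (finsum_eq_zero_of_forall_eq_zero fun j =>
      if_neg fun hj : m j = μ => hdeg (hj ▸ hN j))
  let f : J → k := fun j => c j * (m j).prod fun v e => coord L v ^ e
  let g : J × (CoordIndex n →₀ ℕ) → k := fun z => if m z.1 = z.2 then f z.1 else 0
  have finite_g : (Function.support g).Finite := by
    refine ((finite L).image fun j => (j, m j)).subset ?_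
    rintro ⟨j, μ⟩ hz
    obtain ⟨hj, hne⟩ := ite_ne_right_iff.mp hz
    exact ⟨j, hne, Prod.ext rfl hj⟩
  have monomialValue_eq (μ : CoordIndex n →₀ ℕ) : monomialValue d L μ = ∑ᶠ j, g (j, μ) := by
    rw [monomialValue, finsum_mul]
    refine finsum_congr fun j => ?_
    by_cases hj : m j = μ
    · simp only [g, f, hj, if_true]
    · simp only [g, if_neg hj, zero_mul]
  constructor
  · refine (finite_g.image Prod.snd).subset fun μ hμ => ?_
    by_contra hnot
    refine hμ ((monomialValue_eq μ).trans (finsum_eq_zero_of_forall_eq_zero fun j => ?_))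
    exact not_not.mp fun hj => hnot ⟨(j, μ), hj, rfl⟩
  · calc F L = ∑ᶠ j, f j := hF L
      _ = ∑ᶠ j, ∑ᶠ μ, g (j, μ) := finsum_congr fun j => by
          rw [finsum_eq_single _ (m j) fun μ hμ => if_neg hμ.symm]
          exact (if_pos rfl).symm
      _ = ∑ᶠ μ, ∑ᶠ j, g (j, μ) := finsum_finsum_comm g finite_g
      _ = ∑ᶠ μ, monomialValue d L μ := finsum_congr fun μ => (monomialValue_eq μ).symm

theorem IsPolynomialMap.residue_mem_functionals {Φ : (Fin n → PsiDO n k) → PsiDO n k}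
    (hΦ : IsPolynomialMap Φ) : (fun L => residue (Φ L)) ∈ functionals n k := by
  obtain ⟨J, A, m, ⟨N, hN⟩, hsum⟩ := hΦ
  have residue_term (L : Fin n → PsiDO n k) (j : J) :
      residue (((m j).prod fun v e => coord L v ^ e) • A j) =
        residue (A j) * (m j).prod fun v e => coord L v ^ e := by rw [residue_smul, mul_comm]
  refine mem_functionals_of_forall_eq_finsum (c := fun j => residue (A j)) hN
    (fun L => ?_) fun L => ?_
  · simp only [← residue_term]
    exact (hsum L).finite (-1)
  · simp only [← residue_term]
    exact (hsum L).residue_eq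

/-- The functional `L ↦ res_P(L_{i₁} ⋯ L_{iᵣ})` of a word `w = i₁ ⋯ iᵣ`; every `H_m` is one. -/
noncomputable def wordTrace (w : List (Fin n)) (L : Fin n → PsiDO n k) : k :=
  residue (w.map L).prod

theorem wordTrace_mem_functionals (w : List (Fin n)) : wordTrace w ∈ functionals n k :=
  (isPolynomialMap_prod_map w).residue_mem_functionals

theorem exists_hamiltonian_eq_wordTrace (κ : Fin n → ℕ) :
    ∃ w : List (Fin n), (hamiltonian κ : (Fin n → PsiDO n k) → k) = wordTrace w := by
  have npowRec_eq (i : Fin n) (m : ℕ) (L : Fin n → PsiDO n k) :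
      npowRec m (L i) = ((List.replicate m i).map L).prod := by
    rw [List.map_replicate, List.prod_replicate]
    rfl
  refine ⟨(List.ofFn fun i => List.replicate (κ i) i).flatten, funext fun L => ?_⟩
  simp only [hamiltonian, wordTrace, multiPow, npowRec_eq, List.map_flatten, List.prod_flatten,
    List.map_ofFn, Function.comp_def]

end PolynomialMap

section CyclicGradient

/-- The cyclic gradient at `L` of the noncommutative polynomial `w Z`, with `w` a word in the
variables and `Z` a constant: its `i`-th component is the sum over the factorizations `w = u i v`
of `v(L) * Z * u(L)`. -/
def cyclicGradient {ι A : Type*} [DecidableEq ι] [Semiring A] (L : ι → A) : List ι → A → ι → A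
  | [], _ => 0
  | i :: w, Z => Pi.single i ((w.map L).prod * Z) + cyclicGradient L w (Z * L i)

theorem commute_cyclicGradient {ι A : Type*} [DecidableEq ι] [Semiring A] {L : ι → A} {a : A}
    (hL : ∀ i, Commute a (L i)) (w : List ι) {Z : A} (hZ : Commute a Z) (i : ι) :
    Commute a (cyclicGradient L w Z i) := by
  induction w generalizing Z with
  | nil => exact Commute.zero_right a
  | cons j w ih =>
    refine Commute.add_right ?_ (ih (hZ.mul_right (hL j)))
    have commute_prod : Commute a (w.map L).prod :=
      Commute.list_prod_right _ _ (List.forall_mem_map.mpr fun i _ => hL i)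
    rcases eq_or_ne i j with rfl | hij
    · rw [Pi.single_eq_same]
      exact commute_prod.mul_right hZ
    · rw [Pi.single_eq_of_ne hij]
      exact Commute.zero_right a

theorem pairing_add (M U V : Fin n → PsiDO n k) :
    pairing M (U + V) = pairing M U + pairing M V := by
  simp only [pairing, Pi.add_apply, mul_add, residue_add, Finset.sum_add_distrib]

theorem pairing_comm (L M : Fin n → PsiDO n k) : pairing L M = pairing M L :=
  Finset.sum_congr rfl fun _ _ => residue_mul_comm _ _

theorem hasDerivAlong_residue_prod_mul (w : List (Fin n)) (Z : PsiDO n k)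
    (L M : Fin n → PsiDO n k) :
    HasDerivAlong (fun L => residue ((w.map L).prod * Z)) L M
      (pairing M (cyclicGradient L w Z)) := by
  induction w generalizing Z with
  | nil =>
    refine ⟨Polynomial.C (residue (1 * Z)), fun ε => Polynomial.eval_C.symm, ?_⟩
    rw [Polynomial.derivative_C, Polynomial.eval_zero, cyclicGradient, pairing_comm]
    exact (Finset.sum_eq_zero fun i _ => by rw [Pi.zero_apply, zero_mul, residue_zero]).symm
  | cons i w ih =>
    obtain ⟨p, eval_p, derivative_p⟩ := ih (Z * L i)
    obtain ⟨q, eval_q, -⟩ := ih (Z * M i)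
    have residue_rotate (A : Fin n → PsiDO n k) (B : PsiDO n k) :
        residue (B * (w.map A).prod * Z) = residue ((w.map A).prod * (Z * B)) := by
      rw [mul_assoc, residue_mul_comm, mul_assoc]
    have eval_q_zero : q.eval 0 = residue (M i * ((w.map L).prod * Z)) := by
      rw [← eval_q, zero_smul, add_zero, ← mul_assoc]
      exact (residue_rotate L (M i)).symm
    refine ⟨p + Polynomial.X * q, fun ε => ?_, ?_⟩
    · simp only [List.map_cons, List.prod_cons, residue_rotate]
      rw [Polynomial.eval_add, Polynomial.eval_mul, Polynomial.eval_X, ← eval_p, ← eval_q,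
        ← residue_smul, ← residue_add, Pi.add_apply, Pi.smul_apply, mul_add, mul_add,
        mul_smul_comm, mul_smul_comm]
    · have derivative_eval : (p + Polynomial.X * q).derivative.eval 0 =
          p.derivative.eval 0 + q.eval 0 := by simp
      rw [derivative_eval, derivative_p, eval_q_zero, cyclicGradient, pairing_add,
        pairing_comm M (Pi.single i _), pairing_single_left, residue_mul_comm, add_comm]

theorem isGradient_wordTrace (w : List (Fin n)) (L : Fin n → PsiDO n k) :
    IsGradient (wordTrace w) L (cyclicGradient L w 1) := fun M => by
  simpa only [mul_one] using! hasDerivAlong_residue_prod_mul w 1 L M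

theorem commute_gradient_wordTrace [Infinite k] {L : Fin n → PsiDO n k}
    (hL : L ∈ commutingVariety n k) (w : List (Fin n)) (i : Fin n) :
    Commute (L i) (gradient (wordTrace w) L i) := by
  rw [(isGradient_wordTrace w L).gradient_eq]
  exact commute_cyclicGradient (fun j => sub_eq_zero.mp (hL i j)) w (Commute.one_right _) i

end CyclicGradient

section Involution

theorem pairing_lie_of_commute_left {L X : Fin n → PsiDO n k} (h : ∀ i, Commute (L i) (X i))
    (Y : Fin n → PsiDO n k) : pairing L (lie X Y) = 0 := by
  refine Finset.sum_eq_zero fun i _ => ?_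
  calc residue (L i * (X i * Y i - Y i * X i))
      = residue (L i * X i * Y i) - residue (L i * Y i * X i) := by
        rw [mul_sub, residue_sub, mul_assoc, mul_assoc]
    _ = residue (L i * X i * Y i) - residue (X i * L i * Y i) := by
        rw [residue_mul_comm (L i * Y i), mul_assoc (X i)]
    _ = 0 := by rw [(h i).eq, sub_self]

theorem lie_swap (X Y : Fin n → PsiDO n k) : lie X Y = -lie Y X :=
  funext fun _ => (neg_sub _ _).symm

theorem pairing_smul (c : k) (L M : Fin n → PsiDO n k) :
    pairing L (c • M) = c * pairing L M := by
  simp only [pairing, Pi.smul_apply, mul_smul_comm, residue_smul, Finset.mul_sum]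

theorem pairing_lie_of_commute_right {L Y : Fin n → PsiDO n k} (h : ∀ i, Commute (L i) (Y i))
    (X : Fin n → PsiDO n k) : pairing L (lie X Y) = 0 := by
  rw [lie_swap, ← neg_one_smul k, pairing_smul, pairing_lie_of_commute_left h, mul_zero]

end Involution

end PsiDO

open PsiDO in
theorem proposition7_general {k : Type*} [Field k] [Infinite k] (n : ℕ) :
    (∀ w : List (Fin n), wordTrace w ∈ functionals n k) ∧
    (∀ F ∈ functionals n k, ∀ L, ∃! U, IsGradient F L U) ∧
    ∀ L ∈ commutingVariety n k,
      (∀ w, ∀ F ∈ functionals n k, poisson (wordTrace w) F L = 0) ∧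
      ∀ (R : (Fin n → PsiDO n k) → Fin n → PsiDO n k) (w w' : List (Fin n)),
        pairing L (lie (R (gradient (wordTrace w) L)) (gradient (wordTrace w') L) +
          lie (gradient (wordTrace w) L) (R (gradient (wordTrace w') L))) = 0 := by
  refine ⟨wordTrace_mem_functionals, fun F hF L => ?_, fun L hL => ⟨fun w F _ => ?_, ?_⟩⟩
  · obtain ⟨U, hU⟩ := exists_isGradient hF L
    exact ⟨U, hU, fun V hV => hV.unique hU⟩
  · exact pairing_lie_of_commute_left (commute_gradient_wordTrace hL w) _
  · intro R w w'
    rw [pairing_add, pairing_lie_of_commute_right (commute_gradient_wordTrace hL w'),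
      pairing_lie_of_commute_left (commute_gradient_wordTrace hL w), add_zero]

theorem proposition7 {k : Type*} [Field k] [CharZero k] (n : ℕ) :
    -- the brackets below are those of functionals, and gradients exist and are unique
    (∀ κ : Fin n → ℕ, PsiDO.hamiltonian κ ∈ PsiDO.functionals n k) ∧
    (∀ F ∈ PsiDO.functionals n k, ∀ L : Fin n → PsiDO n k, ∃! U, PsiDO.IsGradient F L U) ∧
    -- the commutation relations on the commuting variety
    ∀ L ∈ PsiDO.commutingVariety n k,
      (∀ κ : Fin n → ℕ, ∀ F ∈ PsiDO.functionals n k,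
        PsiDO.poisson (PsiDO.hamiltonian κ) F L = 0) ∧
      (∀ κ l : Fin n → ℕ,
        PsiDO.poissonR (PsiDO.hamiltonian κ) (PsiDO.hamiltonian l) L = 0) := by
  obtain ⟨mem_functionals, existsUnique_gradient, bracket_eq_zero⟩ :=
    proposition7_general (k := k) n
  choose word hamiltonian_eq using PsiDO.exists_hamiltonian_eq_wordTrace (n := n) (k := k)
  simp only [hamiltonian_eq, PsiDO.poissonR, PsiDO.lieR, ← smul_add, PsiDO.pairing_smul]
  refine ⟨fun κ => mem_functionals _, existsUnique_gradient, fun L hL => ⟨fun κ => ?_, ?_⟩⟩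
  · exact (bracket_eq_zero L hL).1 _
  · exact fun κ l => mul_eq_zero_of_right _ ((bracket_eq_zero L hL).2 PsiDO.rMatrix _ _)
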